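/- **Setting.** Let $I=\{1,\dots,M\}$ be a finite pool of experiments. If an object has true label $\theta\in\{0,1\}$ and experiment $\delta$ is applied, the response $X$ has density $f_{\theta,\delta}$ with respect to a fixed $\sigma$-finite reference measure on a measurable space $\mathcal X$ (e.g. $\mathbb R^d$ with Lebesgue or counting measure); given $\theta$ and the successively chosen experiments $\delta_1,\delta_2,\dots$, the responses $X_1,X_2,\dots$ have joint density $\prod_i f_{\theta,\delta_i}(x_i)$. Let $T\in\mathbb N$ be the truncation length and $c\ge 0$ the cost per response. $\mathcal A^T$ is the set of adaptive sequential designs $(J,N,D)$: $J=(j_n)$ with $\delta_n=j_n(X_1,\dots,X_{n-1})\in I$, a stopping time $N\le T$ (possibly $0$) of the responses, and a decision $D\in\{0,1\}$ that depends on the first $N$ responses. For the prior $P(\theta=1)=\pi_1=1-\pi_0$ its Bayes risk is $$\mathbf R(J,N,D)=\pi_0P(D=1\mid\theta=0)+\pi_1P(D=0\mid\theta=1)+c\{\pi_0E(N\mid\theta=0)+\pi_1E(N\mid\theta=1)\}.$$ **Dynamic program with prior $p$.** For a log-likelihood ratio $l\in[-\infty,\infty]$ put $q_0(l)=\frac{1-p}{1-p+pe^l}$,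 $q_1=1-q_0$, $s_n(l)=\min\{q_0(l),q_1(l)\}+nc$, $G(l,T)=s_T(l)$ and, for $n=T-1,\dots,0$, $$G(l,n)=\min\Big\{\min_{\delta\in I}E_{l,\delta}\,G\big(l+\log\tfrac{f_{1,\delta}(X)}{f_{0,\delta}(X)},n+1\big),\ s_n(l)\Big\},$$ where under $E_{l,\delta}$ the response $X$ has density $q_0(l)f_{0,\delta}+q_1(l)f_{1,\delta}$. Let $j(l,n+1)$ be a minimizing $\delta$ (ties broken in any way that is measurable in $(p,l)$), let $C(n)$ be the set of $l$ for which the first term of the outer minimum is at most the second, and put $A(n)=\sup C(n)$, $B(n)=\inf C(n)$ for $n<T$ (both equal to $\log\frac{1-p}{p}$ if $C(n)$ is empty) and $A(T)=B(T)=\log\frac{1-p}{p}$. The resulting test selects $\delta_{n+1}=j(l_n,n+1)$, where $l_0=0$ and $l_n=\sum_{i\le n}\log\frac{f_{1,\delta_i}(X_i)}{f_{0,\delta_i}(X_i)}$, stops at $N=\min\{n\ge0:\ l_n\ge A(n)\text{ or }l_n\le B(n)\}\le T$, and decides $D=1$ if $l_N\ge A(N)$ and $D=0$ otherwise. **Empirical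 Bayes procedure.** The labels $\theta_1,\theta_2,\dots$ are i.i.d. with $P(\theta_k=1)=\pi_1$. Put $\hat\pi_1^{(0)}=1/2$. Object $k$ is tested with the above test for the prior $p=\hat\pi_1^{(k-1)}$, which gives $N_k$ and $D_k$: conditionally on the labels and responses of objects $1,\dots,k-1$, the label $\theta_k$ is Bernoulli$(\pi_1)$ and the responses of object $k$ are generated from $\theta_k$ by the experiments that this test selects. For $k\ge1$, $\hat\pi_1^{(k)}\in[0,1]$ is any measurable function of the responses collected for objects $1,\dots,k$. Let $$L_K=\frac1K\sum_{k=1}^K\big[\mathbf 1\{D_k\ne\theta_k\}+cN_k\big].$$ **Theorem.** Assume $c<\pi_1<1-c$ and that $\hat\pi_1^{(K)}\to\pi_1$ in probability as $K\to\infty$. Then the minimum of $\mathbf R$ over $\mathcal A^T$ under the true prior $\pi_1$ is attained, and $$L_K\ \longrightarrow\ \min_{(J,N,D)\in\mathcal A^T}\mathbf R(J,N,D)\quad\text{in probability as }K\to\infty .$$ -/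

import Mathlib

open MeasureTheory Filter Set
open scoped ENNReal NNReal

noncomputable section

/-- A pool of `M` experiments.  If the true label is `θ` and experiment `δ` is used, the response
has density `f θ δ` with respect to the reference measure `ν` (Lebesgue measure for continuous
responses, counting measure for discrete ones). -/
structure ResponseModel (M : ℕ) (𝓧 : Type*) [MeasurableSpace 𝓧] where
  ν : Measure 𝓧
  sigmaFinite : SigmaFinite ν
  f : Fin 2 → Fin M → 𝓧 → ℝ≥0
  measurable_f : ∀ θ δ, Measurable (f θ δ)
  lintegral_f : ∀ θ δ, ∫⁻ x, (f θ δ x : ℝ≥0∞) ∂ν = 1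

namespace ResponseModel

variable {M : ℕ} {𝓧 : Type*} [MeasurableSpace 𝓧]

/-- The law of one response from experiment `δ` when the true label is `θ`. -/
def respLaw (R : ResponseModel M 𝓧) (θ : Fin 2) (δ : Fin M) : Measure 𝓧 :=
  R.ν.withDensity (fun x => (R.f θ δ x : ℝ≥0∞))

/-- The increment `log (f₁ / f₀)` of the log-likelihood ratio.  It is `+∞` where only `f₀` vanishes
and `-∞` where only `f₁` vanishes. -/
def logRatio (R : ResponseModel M 𝓧) (δ : Fin M) (x : 𝓧) : EReal :=
  ENNReal.log ((R.f 1 δ x : ℝ≥0∞) / (R.f 0 δ x : ℝ≥0∞))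

/-- The law of the responses `x₀, …, x_{T-1}` when the true label is `θ` and the `(n+1)`-st
experiment is `δ n x` (a function of `x₀, …, x_{n-1}` in all uses): the joint density is
`∏ n, f θ (δ n x) (x n)`. -/
def seqLaw (R : ResponseModel M 𝓧) {T : ℕ} (θ : Fin 2) (δ : Fin T → (Fin T → 𝓧) → Fin M) :
    Measure (Fin T → 𝓧) :=
  haveI := R.sigmaFinite
  (Measure.pi (fun _ : Fin T => R.ν)).withDensity
    (fun x => ∏ n : Fin T, (R.f θ (δ n x) (x n) : ℝ≥0∞))

end ResponseModel

/-- The first `n` responses. -/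
def firstResponses {T : ℕ} {𝓧 : Type*} {n : ℕ} (h : n ≤ T) (x : Fin T → 𝓧) : Fin n → 𝓧 :=
  fun i => x (Fin.castLE h i)

/-- The `σ`-algebra generated by the first `n` responses. -/
abbrev responseSigma {T : ℕ} (𝓧 : Type*) [MeasurableSpace 𝓧] {n : ℕ} (h : n ≤ T) :
    MeasurableSpace (Fin T → 𝓧) :=
  MeasurableSpace.comap (firstResponses h) inferInstance

/-- The adaptive sequential designs `(J, N, D)` with `N ≤ T`. -/
structure AdaptiveDesign (M T : ℕ) (𝓧 : Type*) [MeasurableSpace 𝓧] where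
  /-- `J n` chooses the `(n+1)`-st experiment from the first `n` responses. -/
  J : (n : Fin T) → (Fin n → 𝓧) → Fin M
  measurable_J : ∀ n, Measurable (J n)
  /-- The stopping time. -/
  N : (Fin T → 𝓧) → ℕ
  N_le : ∀ x, N x ≤ T
  measurableSet_N : ∀ (n : ℕ) (h : n ≤ T), MeasurableSet[responseSigma 𝓧 h] {x | N x = n}
  /-- The decision, made from the responses up to the stopping time. -/
  D : (Fin T → 𝓧) → Fin 2
  measurableSet_D : ∀ (n : ℕ) (h : n ≤ T) (a : Fin 2),
    MeasurableSet[responseSigma 𝓧 h] {x | N x = n ∧ D x = a}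

section Risk

variable {M T : ℕ} {𝓧 : Type*} [MeasurableSpace 𝓧]

/-- The law of the responses under the design `d` when the true label is `θ`. -/
def AdaptiveDesign.law (R : ResponseModel M 𝓧) (d : AdaptiveDesign M T 𝓧) (θ : Fin 2) :
    Measure (Fin T → 𝓧) :=
  R.seqLaw θ (fun n x => d.J n (firstResponses n.isLt.le x))

/-- The Bayes risk `R(J, N, D)` under the prior `P(θ = 1) = π₁`. -/
def bayesRisk (R : ResponseModel M 𝓧) (c π₁ : ℝ) (d : AdaptiveDesign M T 𝓧) : ℝ :=
  (1 - π₁) * (d.law R 0).real {x | d.D x = 1} + π₁ * (d.law R 1).real {x | d.D x = 0}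
    + c * ((1 - π₁) * ∫ x, (d.N x : ℝ) ∂(d.law R 0) + π₁ * ∫ x, (d.N x : ℝ) ∂(d.law R 1))

end Risk

section DynamicProgramming

variable {M : ℕ} {𝓧 : Type*} [MeasurableSpace 𝓧]

/-- The posterior probability `π₀ / (π₀ + π₁ eˡ)` of `θ = 0`, where `p = π₁`. -/
def posterior0 (p : ℝ) (l : EReal) : ℝ :=
  (ENNReal.ofReal (1 - p) / (ENNReal.ofReal (1 - p) + ENNReal.ofReal p * EReal.exp l)).toReal

/-- The posterior probability `π₁ eˡ / (π₀ + π₁ eˡ)` of `θ = 1`, where `p = π₁`. -/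
def posterior1 (p : ℝ) (l : EReal) : ℝ := 1 - posterior0 p l

/-- The conditional risk of stopping with `n` responses and log-likelihood ratio `l`. -/
def stopRisk (c p : ℝ) (n : ℕ) (l : EReal) : ℝ :=
  min (posterior0 p l) (posterior1 p l) + n * c

/-- `E_{l,δ} g (l + log (f₁ / f₀) (X))`, with `X` drawn from the predictive distribution of a
response from experiment `δ`. -/
def predictive (R : ResponseModel M 𝓧) (p : ℝ) (g : EReal → ℝ) (l : EReal) (δ : Fin M) : ℝ :=
  posterior0 p l * ∫ x, g (l + R.logRatio δ x) ∂(R.respLaw 0 δ)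
    + posterior1 p l * ∫ x, g (l + R.logRatio δ x) ∂(R.respLaw 1 δ)

/-- The function `G(l, n)` computed by backward induction from `n = T`. -/
def dpG (R : ResponseModel M 𝓧) (c p : ℝ) (T : ℕ) (n : ℕ) (l : EReal) : ℝ :=
  if n < T then
    min (⨅ δ : Fin M, predictive R p (fun l' => dpG R c p T (n + 1) l') l δ) (stopRisk c p n l)
  else stopRisk c p T l
termination_by T - n

/-- The expected next-stage risk when the `(n+1)`-st experiment is `δ`. -/
def nextRisk (R : ResponseModel M 𝓧) (c p : ℝ) (T n : ℕ) (l : EReal) (δ : Fin M) : ℝ :=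
  predictive R p (dpG R c p T (n + 1)) l δ

/-- `j p n l` is the experiment that the dynamic programming algorithm run with the prior `p`
selects as the `(n+1)`-st one when the current log-likelihood ratio is `l`: a minimizer of the
expected next-stage risk, with ties broken in an arbitrary measurable way. -/
structure IsSelectionRule (R : ResponseModel M 𝓧) (c : ℝ) (T : ℕ)
    (j : ℝ → ℕ → EReal → Fin M) : Prop where
  isArgmin : ∀ p ∈ Icc (0 : ℝ) 1, ∀ n < T, ∀ (l : EReal) (δ : Fin M),
    nextRisk R c p T n l (j p n l) ≤ nextRisk R c p T n l δ
  measurable : ∀ n < T, Measurable (fun q : ℝ × EReal => j q.1 n q.2)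

/-- The set `C(n)` of log-likelihood ratios at which continuing is at least as good as stopping. -/
def contSet (R : ResponseModel M 𝓧) (c p : ℝ) (T n : ℕ) : Set EReal :=
  {l | (⨅ δ : Fin M, nextRisk R c p T n l δ) ≤ stopRisk c p n l}

/-- `log (π₀ / π₁)`, where `p = π₁`. -/
def logPriorOdds (p : ℝ) : EReal := ENNReal.log (ENNReal.ofReal (1 - p) / ENNReal.ofReal p)

/-- The upper boundary `A(n)`: the supremum of `C(n)` for `n < T`, and `A(T) = log (π₀ / π₁)`.  A
nonempty `C(n)` contains `log (π₀ / π₁)`, so the maximum only fixes the value `log (π₀ / π₁)` when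
`C(n)` is empty. -/
def upperBoundary (R : ResponseModel M 𝓧) (c p : ℝ) (T n : ℕ) : EReal :=
  if n < T then max (logPriorOdds p) (sSup (contSet R c p T n)) else logPriorOdds p

/-- The lower boundary `B(n)`: the infimum of `C(n)` for `n < T`, and `B(T) = log (π₀ / π₁)`. -/
def lowerBoundary (R : ResponseModel M 𝓧) (c p : ℝ) (T n : ℕ) : EReal :=
  if n < T then min (logPriorOdds p) (sInf (contSet R c p T n)) else logPriorOdds p

variable {T : ℕ}

/-- The log-likelihood ratio `l_n` of the first `n` responses when the experiments are selected by
`j` (only `n ≤ T` matters). -/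
def sprtLLR (R : ResponseModel M 𝓧) (j : ℝ → ℕ → EReal → Fin M) (p : ℝ) (x : Fin T → 𝓧) :
    ℕ → EReal
  | 0 => 0
  | n + 1 =>
    if h : n < T then
      sprtLLR R j p x n + R.logRatio (j p n (sprtLLR R j p x n)) (x ⟨n, h⟩)
    else sprtLLR R j p x n

/-- The `(n+1)`-st experiment `j(l_n, n+1)`. -/
def sprtSel (R : ResponseModel M 𝓧) (j : ℝ → ℕ → EReal → Fin M) (p : ℝ) (n : Fin T)
    (x : Fin T → 𝓧) : Fin M :=
  j p n (sprtLLR R j p x n)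

/-- The sample size: the first `n ∈ {0, …, T}` with `l_n ≥ A(n)` or `l_n ≤ B(n)`.  Since
`A(T) = B(T)`, it is at most `T`. -/
def sprtN (R : ResponseModel M 𝓧) (c : ℝ) (j : ℝ → ℕ → EReal → Fin M) (p : ℝ)
    (x : Fin T → 𝓧) : ℕ :=
  sInf {n | upperBoundary R c p T n ≤ sprtLLR R j p x n ∨
    sprtLLR R j p x n ≤ lowerBoundary R c p T n}

/-- The decision: `1` if the upper boundary is hit, `0` otherwise. -/
def sprtD (R : ResponseModel M 𝓧) (c : ℝ) (j : ℝ → ℕ → EReal → Fin M) (p : ℝ)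
    (x : Fin T → 𝓧) : Fin 2 :=
  open Classical in
  if upperBoundary R c p T (sprtN R c j p x) ≤ sprtLLR R j p x (sprtN R c j p x) then 1 else 0

/-- The joint law of the true label and the responses of one object, when the label has the true
prior `P(θ = 1) = π₁` and the experiments are selected using the prior `p`. -/
def objectLaw (R : ResponseModel M 𝓧) (j : ℝ → ℕ → EReal → Fin M) (T : ℕ) (π₁ p : ℝ) :
    Measure (Fin 2 × (Fin T → 𝓧)) :=
  ENNReal.ofReal (1 - π₁) • (Measure.dirac 0).prod (R.seqLaw 0 (sprtSel R j p))
    + ENNReal.ofReal π₁ • (Measure.dirac 1).prod (R.seqLaw 1 (sprtSel R j p))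

end DynamicProgramming

section EmpiricalBayes

variable {M T : ℕ} {𝓧 Ω : Type*} [MeasurableSpace 𝓧] [MeasurableSpace Ω]

/-- The `σ`-algebra of the true labels and the responses of the objects `0, …, k-1`. -/
abbrev pastSigma (θ : ℕ → Ω → Fin 2) (X : ℕ → Ω → Fin T → 𝓧) (k : ℕ) : MeasurableSpace Ω :=
  ⨆ i : Fin k, MeasurableSpace.comap (fun ω => (θ i ω, X i ω)) inferInstance

/-- The `σ`-algebra of the collected responses of the objects `0, …, k-1`: the response `X i ω n`
is collected when `n < N i ω`. -/
abbrev collectedSigma (N : ℕ → Ω → ℕ) (X : ℕ → Ω → Fin T → 𝓧) (k : ℕ) : MeasurableSpace Ω :=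
  MeasurableSpace.generateFrom
    {E | ∃ i < k, ∃ (n : Fin T) (S : Set 𝓧), MeasurableSet S ∧
      E = {ω | (n : ℕ) < N i ω ∧ X i ω n ∈ S}}

/-- A run of the empirical Bayes procedure on the objects `0, 1, 2, …` with true labels `θ k`,
responses `X k` and prior estimates `est k`.  Object `k` is treated by the design that the dynamic
programming algorithm returns for the prior `est k`, and `est k` is computed from the responses
collected for the objects before it. -/
structure IsEmpiricalBayesRun (R : ResponseModel M 𝓧) (c π₁ : ℝ)
    (j : ℝ → ℕ → EReal → Fin M) (μ : Measure Ω)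
    (θ : ℕ → Ω → Fin 2) (X : ℕ → Ω → Fin T → 𝓧) (est : ℕ → Ω → ℝ) : Prop where
  measurable_label : ∀ k, Measurable (θ k)
  measurable_resp : ∀ k, Measurable (X k)
  est_zero : ∀ ω, est 0 ω = 1 / 2
  est_mem : ∀ k ω, est k ω ∈ Icc (0 : ℝ) 1
  /-- The estimate is a function of the collected responses. -/
  est_collected : ∀ k,
    Measurable[collectedSigma (fun i ω => sprtN R c j (est i ω) (X i ω)) X k] (est k)
  /-- Given the previous objects, the label is Bernoulli with the true prior `π₁`, and the
  responses are generated from the label by the experiments that the procedure selects. -/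
  condLaw : ∀ (k : ℕ) (S : Set (Fin 2 × (Fin T → 𝓧))), MeasurableSet S →
    μ[((fun ω => (θ k ω, X k ω)) ⁻¹' S).indicator (fun _ => (1 : ℝ)) | pastSigma θ X k]
      =ᵐ[μ] fun ω => (objectLaw R j T π₁ (est k ω)).real S

/-- The averaged loss `L_K = K⁻¹ ∑_{k < K} (1{D_k ≠ θ_k} + c N_k)` of the procedure. -/
def averagedLoss (R : ResponseModel M 𝓧) (c : ℝ) (j : ℝ → ℕ → EReal → Fin M)
    (θ : ℕ → Ω → Fin 2) (X : ℕ → Ω → Fin T → 𝓧) (est : ℕ → Ω → ℝ) (K : ℕ) (ω : Ω) : ℝ :=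
  (1 / (K : ℝ)) * ∑ k ∈ Finset.range K,
    ((if sprtD R c j (est k ω) (X k ω) ≠ θ k ω then 1 else 0)
      + c * (sprtN R c j (est k ω) (X k ω) : ℝ))

end EmpiricalBayes

end

-- Two facts are combined: the dynamic program is optimal for the prior it is run with, and the cost
-- of running it with a slightly wrong prior is linear in the error.
--
-- Optimality. Posterior probabilities are replaced by unnormalized weights `(a, b)` of the two
-- labels, so that a response `x` from experiment `δ` just multiplies them by `f 0 δ x` and `f 1 δ
-- x`. The value function `optRisk` of the resulting recursion is homogeneous of degree one
-- (`optRisk_mul`), which makes the predictive density in Bayes' formula cancel and identifies it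
-- with `dpG`, up to the cost already paid. It is also superadditive (`optRisk_superadd`), hence
-- monotone, and Lipschitz (`optRisk_add_le`). Homogeneity and monotonicity make each continuation
-- set an interval on either side of the log prior odds; the Lipschitz bound shows that stopping at
-- an endpoint loses nothing. So the boundary test takes an optimal action at every stage
-- (`sprtPolicy_isOptimal`). Induction on the horizon then bounds every design from below
-- (`optRisk_le_weightedRisk`) and shows that the test attains the bound (`weightedRisk_design_le`).
--
-- Stability. The risk `R_q(d)` of a fixed design is affine in the prior `q` with slope at most `C =
-- 1 + cT` in absolute value. If `d_p` is optimal for `p`, then `R_q(d_p) ≤ R_p(d_p) + C|p - q| ≤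
-- R_p(d_q) + C|p - q| ≤ R_q(d_q) + 2C|p - q|`. No continuity of the boundaries or of the selection
-- rule in `p` is needed (`exists_abs_bayesRisk_sprtDesign_sub_le`).
--
-- Averaging. Given the past, the mean loss of object `k` is the risk under the true prior of the
-- design for the estimate (`condExp_eq_integral_kernel`). By stability these conditional means
-- converge in mean to the minimal risk, while the centred losses are bounded martingale
-- differences. A second-moment bound and Cesàro averaging conclude
-- (`tendstoInMeasure_average_of_condExp`).

attribute [instance] ResponseModel.sigmaFinite

attribute [fun_prop] ResponseModel.measurable_f

/-! ### Backward induction in unnormalized weights -/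

namespace ResponseModel

variable {M : ℕ} {𝓧 : Type*} [MeasurableSpace 𝓧]

/-- The least expected loss over `k` remaining responses when the labels `0` and `1` carry the
(unnormalized) weights `a` and `b` and a response costs `c`. -/
noncomputable def optRisk (R : ResponseModel M 𝓧) (c : ℝ≥0∞) : ℕ → ℝ≥0∞ → ℝ≥0∞ → ℝ≥0∞
  | 0, a, b => min a b
  | k + 1, a, b =>
    min (⨅ δ, ((∫⁻ x, optRisk R c k (a * R.f 0 δ x) (b * R.f 1 δ x) ∂(R.ν)) + c * (a + b))) (min a b)

/-- The least expected loss when experiment `δ` is used next and `k` responses remain after it. -/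
noncomputable def contRisk (R : ResponseModel M 𝓧) (c : ℝ≥0∞) (k : ℕ) (a b : ℝ≥0∞) (δ : Fin M) :
    ℝ≥0∞ :=
  (∫⁻ x, R.optRisk c k (a * R.f 0 δ x) (b * R.f 1 δ x) ∂(R.ν)) + c * (a + b)

theorem optRisk_zero (R : ResponseModel M 𝓧) (c a b : ℝ≥0∞) : R.optRisk c 0 a b = min a b := rfl

theorem optRisk_succ (R : ResponseModel M 𝓧) (c : ℝ≥0∞) (k : ℕ) (a b : ℝ≥0∞) :
    R.optRisk c (k + 1) a b = min (⨅ δ, R.contRisk c k a b δ) (min a b) := rfl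

theorem optRisk_le_min (R : ResponseModel M 𝓧) (c : ℝ≥0∞) (k : ℕ) (a b : ℝ≥0∞) :
    R.optRisk c k a b ≤ min a b := by
  cases k with
  | zero => exact le_rfl
  | succ k => exact min_le_right _ _

theorem optRisk_zero_left (R : ResponseModel M 𝓧) (c : ℝ≥0∞) (k : ℕ) (b : ℝ≥0∞) :
    R.optRisk c k 0 b = 0 :=
  le_antisymm ((R.optRisk_le_min c k 0 b).trans (min_le_left _ _)) zero_le

theorem measurable_optRisk (R : ResponseModel M 𝓧) (c : ℝ≥0∞) (k : ℕ) :
    Measurable (fun q : ℝ≥0∞ × ℝ≥0∞ => R.optRisk c k q.1 q.2) := by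
  induction k with
  | zero => exact measurable_fst.min measurable_snd
  | succ k ih =>
    simp only [optRisk]
    refine (Measurable.iInf fun δ => ?_).min (measurable_fst.min measurable_snd)
    refine Measurable.add ?_ (by fun_prop)
    refine Measurable.lintegral_prod_right' (ν := R.ν)
      (f := fun z : (ℝ≥0∞ × ℝ≥0∞) × 𝓧 =>
        R.optRisk c k (z.1.1 * R.f 0 δ z.2) (z.1.2 * R.f 1 δ z.2)) ?_
    exact ih.comp (f := fun z : (ℝ≥0∞ × ℝ≥0∞) × 𝓧 =>
        (z.1.1 * (R.f 0 δ z.2 : ℝ≥0∞), z.1.2 * (R.f 1 δ z.2 : ℝ≥0∞))) (by fun_prop)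

theorem measurable_optRisk_update (R : ResponseModel M 𝓧) (c : ℝ≥0∞) (k : ℕ) (a b : ℝ≥0∞)
    (δ : Fin M) : Measurable fun x => R.optRisk c k (a * R.f 0 δ x) (b * R.f 1 δ x) :=
  (R.measurable_optRisk c k).comp
    (f := fun x => (a * (R.f 0 δ x : ℝ≥0∞), b * (R.f 1 δ x : ℝ≥0∞))) (by fun_prop)

theorem measurable_contRisk (R : ResponseModel M 𝓧) (c : ℝ≥0∞) (k : ℕ) (δ : Fin M) :
    Measurable (fun q : ℝ≥0∞ × ℝ≥0∞ => R.contRisk c k q.1 q.2 δ) := by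
  refine Measurable.add ?_ (by fun_prop)
  refine Measurable.lintegral_prod_right' (ν := R.ν)
    (f := fun z : (ℝ≥0∞ × ℝ≥0∞) × 𝓧 =>
      R.optRisk c k (z.1.1 * R.f 0 δ z.2) (z.1.2 * R.f 1 δ z.2)) ?_
  exact (R.measurable_optRisk c k).comp (f := fun z : (ℝ≥0∞ × ℝ≥0∞) × 𝓧 =>
      (z.1.1 * (R.f 0 δ z.2 : ℝ≥0∞), z.1.2 * (R.f 1 δ z.2 : ℝ≥0∞))) (by fun_prop)

theorem lintegral_weight (R : ResponseModel M 𝓧) (a : ℝ≥0∞) (θ : Fin 2) (δ : Fin M) :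
    ∫⁻ x, a * R.f θ δ x ∂(R.ν) = a := by
  rw [lintegral_const_mul _ (by fun_prop), R.lintegral_f, mul_one]

theorem lintegral_add_weight (R : ResponseModel M 𝓧) (a b : ℝ≥0∞) (δ : Fin M) :
    ∫⁻ x, (a * R.f 0 δ x + b * R.f 1 δ x) ∂(R.ν) = a + b := by
  rw [lintegral_add_left (by fun_prop), lintegral_weight, lintegral_weight]

/-- Minima, integrals and the cost `c * (a + b)` all scale with the weights. This is what absorbs
the normalizing constant of Bayes' formula. The factor `0` is treated apart because it need not
commute with an infimum, which is `∞` for an empty pool. -/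
theorem optRisk_mul (R : ResponseModel M 𝓧) (c : ℝ≥0∞) (k : ℕ) {s : ℝ≥0∞} (hs : s ≠ ∞)
    (a b : ℝ≥0∞) : R.optRisk c k (s * a) (s * b) = s * R.optRisk c k a b := by
  rcases eq_or_ne s 0 with rfl | hs0
  · simp [optRisk_zero_left]
  induction k generalizing a b with
  | zero => exact (mul_min_of_nonneg a b zero_le).symm
  | succ k ih =>
    simp only [optRisk_succ, mul_min_of_nonneg _ _ (zero_le : (0 : ℝ≥0∞) ≤ s),
      ENNReal.mul_iInf_of_ne hs0 hs, contRisk]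
    congr 2
    ext δ
    rw [mul_add s, ← lintegral_const_mul _ (R.measurable_optRisk_update c k a b δ)]
    congr 1
    · simp_rw [mul_assoc, ih]
    · ring

theorem contRisk_mul (R : ResponseModel M 𝓧) (c : ℝ≥0∞) (k : ℕ) {s : ℝ≥0∞} (hs : s ≠ ∞)
    (a b : ℝ≥0∞) (δ : Fin M) :
    R.contRisk c k (s * a) (s * b) δ = s * R.contRisk c k a b δ := by
  simp only [contRisk]
  rw [mul_add s, ← lintegral_const_mul _ (R.measurable_optRisk_update c k a b δ)]
  congr 1
  · simp_rw [mul_assoc, R.optRisk_mul c k hs]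
  · ring

theorem contRisk_superadd_of_optRisk {R : ResponseModel M 𝓧} {c : ℝ≥0∞} {k : ℕ}
    (h : ∀ a b a' b', R.optRisk c k a b + R.optRisk c k a' b' ≤ R.optRisk c k (a + a') (b + b'))
    (a b a' b' : ℝ≥0∞) (δ : Fin M) :
    R.contRisk c k a b δ + R.contRisk c k a' b' δ ≤ R.contRisk c k (a + a') (b + b') δ := by
  simp only [contRisk]
  calc _ = (∫⁻ x, (R.optRisk c k (a * R.f 0 δ x) (b * R.f 1 δ x)
          + R.optRisk c k (a' * R.f 0 δ x) (b' * R.f 1 δ x)) ∂(R.ν)) + c * (a + a' + (b + b')) := by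
        rw [lintegral_add_left (R.measurable_optRisk_update c k a b δ)]; ring
    _ ≤ _ := by
        gcongr with x
        simpa only [add_mul] using h _ _ _ _

/-- A sum of minima is at most the minimum of the sum: two separate problems may be played with
different designs, the pooled one only with a common design. Since the values are nonnegative,
monotonicity in the weights follows. -/
theorem optRisk_superadd (R : ResponseModel M 𝓧) (c : ℝ≥0∞) (k : ℕ) (a b a' b' : ℝ≥0∞) :
    R.optRisk c k a b + R.optRisk c k a' b' ≤ R.optRisk c k (a + a') (b + b') := by
  induction k generalizing a b a' b' with
  | zero =>
    exact le_min (add_le_add (min_le_left _ _) (min_le_left _ _))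
      (add_le_add (min_le_right _ _) (min_le_right _ _))
  | succ k ih =>
    simp only [optRisk_succ]
    refine le_min (le_iInf fun δ => ?_) (le_min ?_ ?_)
    · exact (add_le_add ((min_le_left _ _).trans (iInf_le _ δ))
        ((min_le_left _ _).trans (iInf_le _ δ))).trans
        (contRisk_superadd_of_optRisk ih a b a' b' δ)
    · exact add_le_add ((min_le_right _ _).trans (min_le_left _ _))
        ((min_le_right _ _).trans (min_le_left _ _))
    · exact add_le_add ((min_le_right _ _).trans (min_le_right _ _))
        ((min_le_right _ _).trans (min_le_right _ _))

theorem contRisk_superadd (R : ResponseModel M 𝓧) (c : ℝ≥0∞) (k : ℕ) (a b a' b' : ℝ≥0∞)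
    (δ : Fin M) :
    R.contRisk c k a b δ + R.contRisk c k a' b' δ ≤ R.contRisk c k (a + a') (b + b') δ :=
  contRisk_superadd_of_optRisk (R.optRisk_superadd c k) a b a' b' δ

theorem contRisk_add_le_of_optRisk {R : ResponseModel M 𝓧} {c C : ℝ≥0∞} {k : ℕ}
    (h : ∀ a b s t, R.optRisk c k (a + s) (b + t) ≤ R.optRisk c k a b + C * (s + t))
    (a b s t : ℝ≥0∞) (δ : Fin M) :
    R.contRisk c k (a + s) (b + t) δ ≤ R.contRisk c k a b δ + (C + c) * (s + t) := by
  simp only [contRisk]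
  calc _ ≤ (∫⁻ x, (R.optRisk c k (a * R.f 0 δ x) (b * R.f 1 δ x)
          + C * (s * R.f 0 δ x + t * R.f 1 δ x)) ∂(R.ν)) + c * (a + s + (b + t)) := by
        gcongr with x
        simpa only [add_mul] using h _ _ _ _
    _ = _ := by
        rw [lintegral_add_left (R.measurable_optRisk_update c k a b δ),
          lintegral_const_mul _ (by fun_prop), lintegral_add_weight]
        ring

theorem _root_.ENNReal.min_add_add_le (a b s t C : ℝ≥0∞) :
    min (a + s) (b + t) ≤ min a b + (1 + C) * (s + t) := by
  rcases min_choice a b with h | h <;> rw [h]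
  · refine (min_le_left _ _).trans ?_
    gcongr
    exact le_self_add.trans (le_mul_of_one_le_left zero_le le_self_add)
  · refine (min_le_right _ _).trans ?_
    gcongr
    exact le_add_self.trans (le_mul_of_one_le_left zero_le le_self_add)

/-- Playing the design for `(a, b)` on the extra weight `(s, t)` costs, per unit of weight, at most
one wrong decision and `k` responses. -/
theorem optRisk_add_le (R : ResponseModel M 𝓧) (c : ℝ≥0∞) (k : ℕ) (a b s t : ℝ≥0∞) :
    R.optRisk c k (a + s) (b + t) ≤ R.optRisk c k a b + (1 + k * c) * (s + t) := by
  induction k generalizing a b s t with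
  | zero => exact ENNReal.min_add_add_le a b s t _
  | succ k ih =>
    simp only [optRisk_succ]
    rw [min_add, ENNReal.iInf_add]
    refine le_min (le_iInf fun δ => ((min_le_left _ _).trans (iInf_le _ δ)).trans ?_)
      ((min_le_right _ _).trans (ENNReal.min_add_add_le a b s t _))
    refine (contRisk_add_le_of_optRisk ih a b s t δ).trans_eq ?_
    push_cast
    ring

theorem contRisk_add_le (R : ResponseModel M 𝓧) (c : ℝ≥0∞) (k : ℕ) (a b s t : ℝ≥0∞)
    (δ : Fin M) :
    R.contRisk c k (a + s) (b + t) δ ≤ R.contRisk c k a b δ + (1 + k * c + c) * (s + t) :=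
  contRisk_add_le_of_optRisk (R.optRisk_add_le c k) a b s t δ

theorem le_contRisk (R : ResponseModel M 𝓧) (c : ℝ≥0∞) (k : ℕ) (a b : ℝ≥0∞) (δ : Fin M) :
    c * (a + b) ≤ R.contRisk c k a b δ := le_add_self

/-- Free responses cannot hurt, since they may be ignored. This settles the degenerate case of the
continuation sets. -/
theorem contRisk_zero_cost_le (R : ResponseModel M 𝓧) (k : ℕ) (a b : ℝ≥0∞) (δ : Fin M) :
    R.contRisk 0 k a b δ ≤ min a b := by
  simp only [contRisk, zero_mul, add_zero]
  refine le_min ?_ ?_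
  · refine le_of_le_of_eq ?_ (R.lintegral_weight a 0 δ)
    exact lintegral_mono fun x => (R.optRisk_le_min 0 k _ _).trans (min_le_left _ _)
  · refine le_of_le_of_eq ?_ (R.lintegral_weight b 1 δ)
    exact lintegral_mono fun x => (R.optRisk_le_min 0 k _ _).trans (min_le_right _ _)

end ResponseModel

/-! ### Posterior probabilities and Bayes' formula -/

/-- The posterior probability of the label `0`, as an extended nonnegative real. -/
noncomputable def post0 (p : ℝ) (l : EReal) : ℝ≥0∞ :=
  ENNReal.ofReal (1 - p) / (ENNReal.ofReal (1 - p) + ENNReal.ofReal p * EReal.exp l)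

/-- The posterior probability of the label `1`, as an extended nonnegative real. -/
noncomputable def post1 (p : ℝ) (l : EReal) : ℝ≥0∞ := 1 - post0 p l

theorem post0_le_one (p : ℝ) (l : EReal) : post0 p l ≤ 1 :=
  ENNReal.div_le_of_le_mul (by rw [one_mul]; exact le_self_add)

theorem post1_le_one (p : ℝ) (l : EReal) : post1 p l ≤ 1 := tsub_le_self

theorem post0_ne_top (p : ℝ) (l : EReal) : post0 p l ≠ ∞ :=
  ne_top_of_le_ne_top ENNReal.one_ne_top (post0_le_one p l)

theorem post1_ne_top (p : ℝ) (l : EReal) : post1 p l ≠ ∞ :=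
  ne_top_of_le_ne_top ENNReal.one_ne_top (post1_le_one p l)

theorem post0_add_post1 (p : ℝ) (l : EReal) : post0 p l + post1 p l = 1 :=
  add_tsub_cancel_of_le (post0_le_one p l)

theorem toReal_post0 (p : ℝ) (l : EReal) : (post0 p l).toReal = posterior0 p l := rfl

theorem toReal_post1 (p : ℝ) (l : EReal) : (post1 p l).toReal = posterior1 p l := by
  rw [post1, ENNReal.toReal_sub_of_le (post0_le_one p l) ENNReal.one_ne_top]
  rfl

theorem measurable_post0 : Measurable (fun q : ℝ × EReal => post0 q.1 q.2) := by
  have h : Measurable fun q : ℝ × EReal => EReal.exp q.2 := measurable_snd.ereal_exp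
  unfold post0
  fun_prop

theorem measurable_post1 : Measurable (fun q : ℝ × EReal => post1 q.1 q.2) :=
  measurable_const.sub measurable_post0

theorem post0_of_nonpos {p : ℝ} (hp : p ≤ 0) (l : EReal) : post0 p l = 1 := by
  rw [post0, ENNReal.ofReal_of_nonpos hp, zero_mul, add_zero, ENNReal.div_self]
  · simp; linarith
  · simp

theorem post0_of_one_le {p : ℝ} (hp : 1 ≤ p) (l : EReal) : post0 p l = 0 := by
  rw [post0, ENNReal.ofReal_of_nonpos (by linarith), ENNReal.zero_div]

theorem post0_zero (p : ℝ) (hp : p ∈ Icc (0 : ℝ) 1) : post0 p 0 = ENNReal.ofReal (1 - p) := by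
  rw [post0, EReal.exp_zero, mul_one, ← ENNReal.ofReal_add (by linarith [hp.2]) hp.1]
  simp

theorem post1_zero (p : ℝ) (hp : p ∈ Icc (0 : ℝ) 1) : post1 p 0 = ENNReal.ofReal p := by
  rw [post1, post0_zero p hp, ← ENNReal.ofReal_one, ← ENNReal.ofReal_sub _ (by linarith [hp.2])]
  simp

/-- Bayes' formula with prior weights `a`, `b`, likelihood ratio `e` and new densities `u`, `v`:
predictive density times new posterior equals old posterior times `u`. The extended values are
consistent: when `e = ∞` meets `v = 0`, the product `e * (v / u)` is `0` by convention and the new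
posterior is meaningless, but the predictive density vanishes. -/
theorem ENNReal.mul_div_add_update {a b : ℝ≥0∞} (ha : a ≠ 0) (ha' : a ≠ ∞) (hb : b ≠ 0)
    (hb' : b ≠ ∞) (e : ℝ≥0∞) (u v : ℝ≥0) :
    (a / (a + b * e) * u + (1 - a / (a + b * e)) * v) * (a / (a + b * (e * (v / u))))
      = a / (a + b * e) * u := by
  rcases eq_or_ne v 0 with rfl | hv
  · simp [ENNReal.div_self ha ha']
  have hv0 : (v : ℝ≥0∞) ≠ 0 := by simpa using hv
  rcases eq_or_ne e ∞ with rfl | he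
  · have : (∞ : ℝ≥0∞) * (v / u) = ∞ := ENNReal.top_mul (by simp [hv])
    rw [this]
    simp [ENNReal.mul_top hb]
  rcases eq_or_ne e 0 with rfl | he0
  · simp [ENNReal.div_self ha ha']
  rcases eq_or_ne u 0 with rfl | hu
  · have : e * ((v : ℝ≥0∞) / ((0 : ℝ≥0) : ℝ≥0∞)) = ∞ := by
      rw [ENNReal.coe_zero, ENNReal.div_zero hv0, ENNReal.mul_top he0]
    rw [this]
    simp [ENNReal.mul_top hb]
  lift a to ℝ≥0 using ha'
  lift b to ℝ≥0 using hb'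
  lift e to ℝ≥0 using he
  have ha0 : a ≠ 0 := by simpa using ha
  have h1 : a + b * e ≠ 0 := by positivity
  have h2 : a + b * (e * (v / u)) ≠ 0 := by positivity
  have h3 : 1 - a / (a + b * e) = b * e / (a + b * e) := by
    refine tsub_eq_of_eq_add ?_
    field_simp
    ring
  have e1 : (a : ℝ≥0∞) / (a + b * e) = ((a / (a + b * e) : ℝ≥0) : ℝ≥0∞) := by
    rw [ENNReal.coe_div h1]
    push_cast
    rfl
  have e2 : (a : ℝ≥0∞) / (a + b * (e * (v / u)))
      = ((a / (a + b * (e * (v / u))) : ℝ≥0) : ℝ≥0∞) := by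
    rw [ENNReal.coe_div h2]
    push_cast [ENNReal.coe_div hu]
    rfl
  have e3 : (1 : ℝ≥0∞) - ((a / (a + b * e) : ℝ≥0) : ℝ≥0∞)
      = ((b * e / (a + b * e) : ℝ≥0) : ℝ≥0∞) := by
    rw [← h3]
    push_cast
    rfl
  rw [e1, e2, e3]
  norm_cast
  field_simp

/-! ### The dynamic program in the log-likelihood ratio as backward induction in weights -/

namespace ResponseModel

variable {M : ℕ} {𝓧 : Type*} [MeasurableSpace 𝓧] (R : ResponseModel M 𝓧)

theorem exp_logRatio (δ : Fin M) (x : 𝓧) :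
    EReal.exp (R.logRatio δ x) = (R.f 1 δ x : ℝ≥0∞) / (R.f 0 δ x : ℝ≥0∞) :=
  ENNReal.exp_log _

theorem measurable_logRatio (δ : Fin M) : Measurable (R.logRatio δ) := by
  unfold logRatio
  exact Measurable.ennreal_log (by fun_prop)

theorem post0_update (p : ℝ) (l : EReal) (δ : Fin M) (x : 𝓧) :
    (post0 p l * R.f 0 δ x + post1 p l * R.f 1 δ x) * post0 p (l + R.logRatio δ x)
      = post0 p l * R.f 0 δ x := by
  rcases le_or_gt p 0 with hp | hp
  · simp [post1, post0_of_nonpos hp]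
  rcases le_or_gt 1 p with hp' | hp'
  · simp [post0_of_one_le hp']
  simp only [post0, post1, EReal.exp_add, exp_logRatio]
  exact ENNReal.mul_div_add_update (by simpa) (by simp) (by simpa) (by simp) _ _ _

theorem post1_update (p : ℝ) (l : EReal) (δ : Fin M) (x : 𝓧) :
    (post0 p l * R.f 0 δ x + post1 p l * R.f 1 δ x) * post1 p (l + R.logRatio δ x)
      = post1 p l * R.f 1 δ x := by
  have h0 : post0 p l * (R.f 0 δ x : ℝ≥0∞) ≠ ∞ :=
    ENNReal.mul_ne_top (post0_ne_top p l) ENNReal.coe_ne_top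
  have h := R.post0_update p l δ x
  have h2 := post0_add_post1 p (l + R.logRatio δ x)
  refine (ENNReal.add_right_inj h0).1 ?_
  nth_rewrite 1 [← h]
  rw [← mul_add, h2, mul_one]

theorem contRisk_ne_top {c : ℝ≥0∞} (hc : c ≠ ∞) (k : ℕ) {a b : ℝ≥0∞} (ha : a ≠ ∞) (hb : b ≠ ∞)
    (δ : Fin M) : R.contRisk c k a b δ ≠ ∞ := by
  refine ENNReal.add_ne_top.2 ⟨?_, ENNReal.mul_ne_top hc (ENNReal.add_ne_top.2 ⟨ha, hb⟩)⟩
  refine ne_top_of_le_ne_top (b := a) ha ?_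
  refine le_of_le_of_eq ?_ (R.lintegral_weight a 0 δ)
  exact lintegral_mono fun x => (R.optRisk_le_min c k _ _).trans (min_le_left _ _)

theorem isProbabilityMeasure_respLaw (θ : Fin 2) (δ : Fin M) :
    IsProbabilityMeasure (R.respLaw θ δ) :=
  ⟨by simpa [respLaw] using R.lintegral_f θ δ⟩

/-- Homogeneity with the predictive density as the factor, followed by Bayes' formula. -/
theorem optRisk_post_update (c : ℝ≥0∞) (k : ℕ) (p : ℝ) (l : EReal) (δ : Fin M) (x : 𝓧) :
    (post0 p l * R.f 0 δ x + post1 p l * R.f 1 δ x)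
        * R.optRisk c k (post0 p (l + R.logRatio δ x)) (post1 p (l + R.logRatio δ x))
      = R.optRisk c k (post0 p l * R.f 0 δ x) (post1 p l * R.f 1 δ x) := by
  rw [← R.optRisk_mul c k, R.post0_update, R.post1_update]
  exact ENNReal.add_ne_top.2 ⟨ENNReal.mul_ne_top (post0_ne_top p l) ENNReal.coe_ne_top,
    ENNReal.mul_ne_top (post1_ne_top p l) ENNReal.coe_ne_top⟩

/-- The mixture of the two response laws has density `post0 * f 0 + post1 * f 1`, and this factor
turns the value at the updated posterior into the value at the unnormalized weights. The constant
`d` passes through because the mixture has total mass one. -/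
theorem predictive_eq (c : ℝ≥0∞) (k : ℕ) (d : ℝ) (p : ℝ) (l : EReal) (δ : Fin M) :
    predictive R p (fun l' => (R.optRisk c k (post0 p l') (post1 p l')).toReal + d) l δ
      = (∫⁻ x, R.optRisk c k (post0 p l * R.f 0 δ x) (post1 p l * R.f 1 δ x) ∂(R.ν)).toReal + d := by
  have hpr (θ) := R.isProbabilityMeasure_respLaw θ δ
  set g : 𝓧 → ℝ≥0∞ := fun x =>
    R.optRisk c k (post0 p (l + R.logRatio δ x)) (post1 p (l + R.logRatio δ x)) with hg
  have hgm : Measurable g := by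
    have h1 : Measurable fun x => (p, l + R.logRatio δ x) :=
      measurable_const.prodMk (measurable_const.add (R.measurable_logRatio δ))
    exact (R.measurable_optRisk c k).comp ((measurable_post0.comp h1).prodMk
      (measurable_post1.comp h1))
  have hg1 (x) : g x ≤ 1 := (R.optRisk_le_min c k _ _).trans
    ((min_le_left _ _).trans (post0_le_one _ _))
  have hgl (θ) : ∫⁻ x, g x ∂(R.respLaw θ δ) ≤ 1 :=
    (lintegral_mono hg1).trans (by simp)
  have hgt (θ) : ∫⁻ x, g x ∂(R.respLaw θ δ) ≠ ∞ := ne_top_of_le_ne_top ENNReal.one_ne_top (hgl θ)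
  have hint (θ) : ∫ x, ((g x).toReal + d) ∂(R.respLaw θ δ)
      = (∫⁻ x, g x ∂(R.respLaw θ δ)).toReal + d := by
    rw [integral_add (integrable_toReal_of_lintegral_ne_top hgm.aemeasurable (hgt θ))
      (integrable_const d), integral_toReal hgm.aemeasurable
      (Eventually.of_forall fun x => (hg1 x).trans_lt ENNReal.one_lt_top)]
    simp
  have hpred : predictive R p (fun l' => (R.optRisk c k (post0 p l') (post1 p l')).toReal + d) l δ
      = posterior0 p l * ((∫⁻ x, g x ∂(R.respLaw 0 δ)).toReal + d)
        + posterior1 p l * ((∫⁻ x, g x ∂(R.respLaw 1 δ)).toReal + d) := by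
    rw [← hint, ← hint]
    rfl
  have hsum : posterior0 p l + posterior1 p l = 1 := by simp [posterior1]
  have hmain : (∫⁻ x, R.optRisk c k (post0 p l * R.f 0 δ x) (post1 p l * R.f 1 δ x) ∂(R.ν))
      = post0 p l * ∫⁻ x, g x ∂(R.respLaw 0 δ) + post1 p l * ∫⁻ x, g x ∂(R.respLaw 1 δ) := by
    simp_rw [respLaw]
    rw [lintegral_withDensity_eq_lintegral_mul _ (by fun_prop) hgm,
      lintegral_withDensity_eq_lintegral_mul _ (by fun_prop) hgm,
      ← lintegral_const_mul _ (by fun_prop), ← lintegral_const_mul _ (by fun_prop),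
      ← lintegral_add_left (by fun_prop)]
    refine lintegral_congr fun x => ?_
    rw [← optRisk_post_update]
    simp only [Pi.mul_apply, hg]
    ring
  rw [hpred, hmain, ENNReal.toReal_add (ENNReal.mul_ne_top (post0_ne_top p l) (hgt 0))
    (ENNReal.mul_ne_top (post1_ne_top p l) (hgt 1)), ENNReal.toReal_mul, ENNReal.toReal_mul,
    toReal_post0, toReal_post1]
  linear_combination d * hsum

theorem predictive_eq_contRisk {c : ℝ} (hc : 0 ≤ c) (k n : ℕ) (p : ℝ) (l : EReal) (δ : Fin M) :
    predictive R p (fun l' => (R.optRisk (ENNReal.ofReal c) k (post0 p l') (post1 p l')).toReal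
        + (n + 1 : ℕ) * c) l δ
      = (R.contRisk (ENNReal.ofReal c) k (post0 p l) (post1 p l) δ).toReal + n * c := by
  have h := R.contRisk_ne_top (c := ENNReal.ofReal c) ENNReal.ofReal_ne_top k (post0_ne_top p l)
    (post1_ne_top p l) δ
  rw [contRisk] at h
  rw [predictive_eq, contRisk, ENNReal.toReal_add (ENNReal.add_ne_top.1 h).1
    (ENNReal.add_ne_top.1 h).2, post0_add_post1, mul_one, ENNReal.toReal_ofReal hc]
  push_cast
  ring

theorem toReal_min_post (p : ℝ) (l : EReal) :
    (min (post0 p l) (post1 p l)).toReal = min (posterior0 p l) (posterior1 p l) := by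
  rw [ENNReal.toReal_min (post0_ne_top p l) (post1_ne_top p l), toReal_post0, toReal_post1]

theorem toReal_iInf_contRisk [Nonempty (Fin M)] {c : ℝ≥0∞} (hc : c ≠ ∞) (k : ℕ) {a b : ℝ≥0∞}
    (ha : a ≠ ∞) (hb : b ≠ ∞) (d : ℝ) :
    ⨅ δ, ((R.contRisk c k a b δ).toReal + d) = (⨅ δ, R.contRisk c k a b δ).toReal + d := by
  obtain ⟨δ, hδ⟩ := Finite.exists_min fun δ => R.contRisk c k a b δ
  have h (δ) := R.contRisk_ne_top hc k ha hb δ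
  rw [le_antisymm (iInf_le _ δ) (le_iInf hδ)]
  refine le_antisymm (ciInf_le (Finite.bddBelow_range _) δ) (le_ciInf fun δ' => ?_)
  gcongr
  · exact h δ'
  · exact hδ δ'

theorem iInf_contRisk_ne_top [Nonempty (Fin M)] {c : ℝ≥0∞} (hc : c ≠ ∞) (k : ℕ) {a b : ℝ≥0∞}
    (ha : a ≠ ∞) (hb : b ≠ ∞) : ⨅ δ, R.contRisk c k a b δ ≠ ∞ :=
  ne_top_of_le_ne_top (R.contRisk_ne_top hc k ha hb (Classical.arbitrary _)) (iInf_le _ _)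

/-- `dpG` charges for all responses from the start, `optRisk` only for those to come; hence the
summand `n * c`. -/
theorem dpG_eq [Nonempty (Fin M)] {c : ℝ} (hc : 0 ≤ c) (p : ℝ) {T k n : ℕ} (hkn : n + k = T)
    (l : EReal) :
    dpG R c p T n l
      = (R.optRisk (ENNReal.ofReal c) k (post0 p l) (post1 p l)).toReal + n * c := by
  induction k generalizing n l with
  | zero =>
    rw [dpG, if_neg (by omega), stopRisk, optRisk_zero, toReal_min_post]
    simp [← hkn]
  | succ k ih =>
    have hfun : (fun l' => dpG R c p T (n + 1) l') = fun l' =>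
        (R.optRisk (ENNReal.ofReal c) k (post0 p l') (post1 p l')).toReal + (n + 1 : ℕ) * c :=
      funext fun l' => ih (by omega) l'
    rw [dpG, if_pos (by omega), hfun]
    simp_rw [predictive_eq_contRisk R hc]
    rw [toReal_iInf_contRisk R ENNReal.ofReal_ne_top k (post0_ne_top p l) (post1_ne_top p l),
      stopRisk, ← toReal_min_post, min_add_add_right, optRisk_succ, ENNReal.toReal_min
        (R.iInf_contRisk_ne_top ENNReal.ofReal_ne_top k (post0_ne_top p l) (post1_ne_top p l))
        (ne_top_of_le_ne_top (post0_ne_top p l) (min_le_left _ _))]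

theorem nextRisk_eq [Nonempty (Fin M)] {c : ℝ} (hc : 0 ≤ c) (p : ℝ) {T k n : ℕ}
    (hkn : n + (k + 1) = T) (l : EReal) (δ : Fin M) :
    nextRisk R c p T n l δ
      = (R.contRisk (ENNReal.ofReal c) k (post0 p l) (post1 p l) δ).toReal + n * c := by
  rw [← predictive_eq_contRisk R hc]
  unfold nextRisk
  congr 1
  funext l'
  exact dpG_eq R hc p (by omega) l'

theorem mem_contSet_iff [Nonempty (Fin M)] {c : ℝ} (hc : 0 ≤ c) (p : ℝ) {T k n : ℕ}
    (hkn : n + (k + 1) = T) (l : EReal) :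
    l ∈ contSet R c p T n ↔ ⨅ δ, R.contRisk (ENNReal.ofReal c) k (post0 p l) (post1 p l) δ
      ≤ min (post0 p l) (post1 p l) := by
  simp only [contSet, mem_ofPred_eq, nextRisk_eq R hc p hkn]
  rw [toReal_iInf_contRisk R ENNReal.ofReal_ne_top k (post0_ne_top p l) (post1_ne_top p l),
    stopRisk, ← toReal_min_post, add_le_add_iff_right, ENNReal.toReal_le_toReal]
  · exact iInf_contRisk_ne_top R ENNReal.ofReal_ne_top k (post0_ne_top p l) (post1_ne_top p l)
  · exact ne_top_of_le_ne_top (post0_ne_top p l) (min_le_left _ _)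

end ResponseModel

/-! ### Laws of adaptively selected responses -/

theorem measurable_firstResponses {T n : ℕ} {𝓧 : Type*} [MeasurableSpace 𝓧] (h : n ≤ T) :
    Measurable (firstResponses (𝓧 := 𝓧) h) :=
  measurable_pi_lambda _ fun _ => measurable_pi_apply _

theorem responseSigma_le {T n : ℕ} (𝓧 : Type*) [MeasurableSpace 𝓧] (h : n ≤ T) :
    responseSigma 𝓧 h ≤ MeasurableSpace.pi :=
  (measurable_firstResponses h).comap_le

theorem firstResponses_cons {T n : ℕ} {𝓧 : Type*} (h : n ≤ T) (h' : n + 1 ≤ T + 1) (x₀ : 𝓧)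
    (y : Fin T → 𝓧) :
    firstResponses h' (Fin.cons x₀ y : Fin (T + 1) → 𝓧)
      = (Fin.cons x₀ (firstResponses h y) : Fin (n + 1) → 𝓧) := by
  funext i
  refine Fin.cases ?_ (fun i => ?_) i <;> rfl

theorem measurable_finCons {T : ℕ} {𝓧 : Type*} [MeasurableSpace 𝓧] :
    Measurable (fun z : 𝓧 × (Fin T → 𝓧) => (Fin.cons z.1 z.2 : Fin (T + 1) → 𝓧)) := by
  refine measurable_pi_lambda _ fun i => ?_
  refine Fin.cases ?_ (fun i => ?_) i
  · exact measurable_fst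
  · exact (measurable_pi_apply i).comp measurable_snd

theorem measurable_finCons_right {T : ℕ} {𝓧 : Type*} [MeasurableSpace 𝓧] (x₀ : 𝓧) :
    Measurable (fun y : Fin T → 𝓧 => (Fin.cons x₀ y : Fin (T + 1) → 𝓧)) :=
  measurable_finCons.comp (measurable_const.prodMk measurable_id)

/-- The empty sequence of responses. -/
def noResponses {T : ℕ} {𝓧 : Type*} : Fin ((0 : Fin (T + 1)) : ℕ) → 𝓧 := Fin.elim0

namespace ResponseModel

variable {M T : ℕ} {𝓧 : Type*} [MeasurableSpace 𝓧] (R : ResponseModel M 𝓧)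

/-- The law of the responses when the experiments are selected by `J`. -/
noncomputable def adaptedLaw (θ : Fin 2) (J : (n : Fin T) → (Fin n → 𝓧) → Fin M) :
    Measure (Fin T → 𝓧) :=
  R.seqLaw θ (fun n x => J n (firstResponses n.isLt.le x))

/-- The selection rule that remains after the first response `x₀`. -/
def tailRule (J : (n : Fin (T + 1)) → (Fin n → 𝓧) → Fin M) (x₀ : 𝓧) :
    (n : Fin T) → (Fin n → 𝓧) → Fin M :=
  fun n y => J n.succ (Fin.cons x₀ y : Fin (n + 1) → 𝓧)

theorem measurable_tailRule {J : (n : Fin (T + 1)) → (Fin n → 𝓧) → Fin M}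
    (hJ : ∀ n, Measurable (J n)) (x₀ : 𝓧) (n : Fin T) : Measurable (tailRule J x₀ n) :=
  (hJ n.succ).comp (measurable_finCons_right x₀)

theorem measurable_density_comp {α : Type*} [MeasurableSpace α] (θ : Fin 2) {δ : α → Fin M}
    {x : α → 𝓧} (hδ : Measurable δ) (hx : Measurable x) :
    Measurable fun a => (R.f θ (δ a) (x a) : ℝ≥0∞) := by
  have h : Measurable fun q : Fin M × 𝓧 => (R.f θ q.1 q.2 : ℝ≥0∞) :=
    measurable_from_prod_countable_right fun δ => (R.measurable_f θ δ).coe_nnreal_ennreal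
  exact h.comp (hδ.prodMk hx)

theorem measurable_seqDensity {α : Type*} [MeasurableSpace α] (θ : Fin 2)
    {δ : Fin T → α → Fin M} {x : α → Fin T → 𝓧} (hδ : ∀ n, Measurable (δ n))
    (hx : Measurable x) :
    Measurable fun a => ∏ n : Fin T, (R.f θ (δ n a) (x a n) : ℝ≥0∞) :=
  Finset.measurable_prod _ fun n _ =>
    R.measurable_density_comp θ (hδ n) ((measurable_pi_apply n).comp hx)

theorem lintegral_seqLaw (θ : Fin 2) {δ : Fin T → (Fin T → 𝓧) → Fin M}
    (hδ : ∀ n, Measurable (δ n)) {g : (Fin T → 𝓧) → ℝ≥0∞} (hg : Measurable g) :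
    ∫⁻ x, g x ∂(R.seqLaw θ δ)
      = ∫⁻ x, (∏ n : Fin T, (R.f θ (δ n x) (x n) : ℝ≥0∞)) * g x ∂(Measure.pi fun _ => R.ν) :=
  lintegral_withDensity_eq_lintegral_mul _ (R.measurable_seqDensity θ hδ measurable_id) hg

theorem lintegral_adaptedLaw_zero (θ : Fin 2) (J : (n : Fin 0) → (Fin n → 𝓧) → Fin M)
    {g : (Fin 0 → 𝓧) → ℝ≥0∞} (hg : Measurable g) :
    ∫⁻ x, g x ∂(R.adaptedLaw θ J) = g Fin.elim0 := by
  rw [adaptedLaw, R.lintegral_seqLaw θ (fun n => n.elim0) hg, Measure.pi_of_empty _ Fin.elim0]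
  simp

/-- The joint density is the density of the first response times the density belonging to the rule
that remains after it; Fubini separates the two. All inductions on the horizon rest on this. -/
theorem lintegral_adaptedLaw_succ (θ : Fin 2) {J : (n : Fin (T + 1)) → (Fin n → 𝓧) → Fin M}
    (hJ : ∀ n, Measurable (J n)) {g : (Fin (T + 1) → 𝓧) → ℝ≥0∞} (hg : Measurable g) :
    ∫⁻ x, g x ∂(R.adaptedLaw θ J)
      = ∫⁻ x₀, (R.f θ (J 0 noResponses) x₀ : ℝ≥0∞)
          * ∫⁻ y, g (Fin.cons x₀ y) ∂(R.adaptedLaw θ (tailRule J x₀)) ∂(R.ν) := by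
  have hm (n : Fin (T + 1)) :
      Measurable fun x : Fin (T + 1) → 𝓧 => J n (firstResponses n.isLt.le x) :=
    (hJ n).comp (measurable_firstResponses _)
  have hG : Measurable fun x : Fin (T + 1) → 𝓧 => (∏ n : Fin (T + 1),
      (R.f θ (J n (firstResponses n.isLt.le x)) (x n) : ℝ≥0∞)) * g x :=
    (R.measurable_seqDensity θ hm measurable_id).mul hg
  rw [adaptedLaw, R.lintegral_seqLaw θ hm hg,
    ← ((measurePreserving_piFinSuccAbove (fun _ => R.ν) 0).symm).lintegral_comp hG]
  simp only [MeasurableEquiv.piFinSuccAbove_symm_apply, Fin.insertNthEquiv, Equiv.coe_fn_mk,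
    Fin.insertNth_zero']
  have hgm : Measurable fun z : 𝓧 × (Fin T → 𝓧) => (∏ n : Fin (T + 1),
      (R.f θ (J n (firstResponses n.isLt.le (Fin.cons z.1 z.2 : Fin (T + 1) → 𝓧)))
        ((Fin.cons z.1 z.2 : Fin (T + 1) → 𝓧) n) : ℝ≥0∞)) * g (Fin.cons z.1 z.2) :=
    hG.comp measurable_finCons
  rw [lintegral_prod _ hgm.aemeasurable]
  refine lintegral_congr fun x₀ => ?_
  have hm' (n : Fin T) :
      Measurable fun y : Fin T → 𝓧 => tailRule J x₀ n (firstResponses n.isLt.le y) :=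
    (measurable_tailRule hJ x₀ n).comp (measurable_firstResponses _)
  have hg' : Measurable fun y : Fin T → 𝓧 => g (Fin.cons x₀ y) :=
    hg.comp (measurable_finCons_right x₀)
  have hG' : Measurable fun y : Fin T → 𝓧 => (∏ n : Fin T,
      (R.f θ (tailRule J x₀ n (firstResponses n.isLt.le y)) (y n) : ℝ≥0∞)) * g (Fin.cons x₀ y) :=
    (R.measurable_seqDensity θ hm' measurable_id).mul hg'
  rw [adaptedLaw, R.lintegral_seqLaw θ hm' hg', ← lintegral_const_mul _ hG']
  refine lintegral_congr fun y => ?_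
  rw [Fin.prod_univ_succ, mul_assoc]
  congr 3
  congr 1
  · exact funext fun i => i.elim0
  · funext n
    exact congrArg (fun z => (R.f θ (J n.succ z) (y n) : ℝ≥0∞))
      (firstResponses_cons n.isLt.le n.succ.isLt.le x₀ y)

theorem measurable_lintegral_tailRule (θ : Fin 2)
    {J : (n : Fin (T + 1)) → (Fin n → 𝓧) → Fin M} (hJ : ∀ n, Measurable (J n))
    {g : (Fin (T + 1) → 𝓧) → ℝ≥0∞} (hg : Measurable g) :
    Measurable fun x₀ => ∫⁻ y, g (Fin.cons x₀ y) ∂(R.adaptedLaw θ (tailRule J x₀)) := by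
  have hm (n : Fin T) : Measurable fun z : 𝓧 × (Fin T → 𝓧) =>
      tailRule J z.1 n (firstResponses n.isLt.le z.2) :=
    (hJ n.succ).comp (measurable_finCons.comp
      (measurable_fst.prodMk ((measurable_firstResponses _).comp measurable_snd)))
  have h (x₀ : 𝓧) := R.lintegral_seqLaw θ
    (fun n => (measurable_tailRule hJ x₀ n).comp (measurable_firstResponses n.isLt.le))
    (hg.comp (measurable_finCons_right x₀))
  have hmeas := Measurable.lintegral_prod_right' (ν := Measure.pi fun _ : Fin T => R.ν)
    ((R.measurable_seqDensity θ hm measurable_snd).mul (hg.comp measurable_finCons))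
  -- The measure depends on `x₀`; written with densities, the integral is against a fixed product
  -- measure and has a jointly measurable integrand.
  exact (funext h : _ = _) ▸ hmeas

theorem isProbabilityMeasure_adaptedLaw (θ : Fin 2) {J : (n : Fin T) → (Fin n → 𝓧) → Fin M}
    (hJ : ∀ n, Measurable (J n)) : IsProbabilityMeasure (R.adaptedLaw θ J) := by
  refine ⟨?_⟩
  rw [← lintegral_one]
  induction T with
  | zero => exact R.lintegral_adaptedLaw_zero θ J measurable_const
  | succ T ih =>
    rw [R.lintegral_adaptedLaw_succ θ hJ measurable_const]
    simp_rw [ih (measurable_tailRule hJ _), mul_one]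
    exact R.lintegral_f _ _

end ResponseModel

/-! ### Every adaptive design obeys the lower bound of backward induction -/

namespace AdaptiveDesign

variable {M T : ℕ} {𝓧 : Type*} [MeasurableSpace 𝓧]

theorem measurable_N (d : AdaptiveDesign M T 𝓧) : Measurable d.N := by
  refine measurable_to_countable' fun n => ?_
  rcases le_or_gt n T with h | h
  · exact responseSigma_le 𝓧 h _ (d.measurableSet_N n h)
  · convert MeasurableSet.empty
    ext x
    simpa using ((d.N_le x).trans_lt h).ne

theorem measurable_D (d : AdaptiveDesign M T 𝓧) : Measurable d.D := by
  refine measurable_to_countable' fun a => ?_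
  have : d.D ⁻¹' {a} = ⋃ n : Fin (T + 1), {x | d.N x = n ∧ d.D x = a} := by
    ext x
    simp only [mem_preimage, mem_singleton_iff, mem_iUnion, mem_ofPred_eq]
    exact ⟨fun h => ⟨⟨d.N x, Nat.lt_succ_of_le (d.N_le x)⟩, rfl, h⟩, fun ⟨_, h⟩ => h.2⟩
  rw [this]
  exact MeasurableSet.iUnion fun n =>
    responseSigma_le 𝓧 (Nat.lt_succ_iff.1 n.2) _ (d.measurableSet_D n (Nat.lt_succ_iff.1 n.2) a)

/-- The loss: `1` for a wrong decision, plus the cost `c` of every response. -/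
noncomputable def loss (d : AdaptiveDesign M T 𝓧) (c : ℝ≥0∞) (θ : Fin 2) (x : Fin T → 𝓧) : ℝ≥0∞ :=
  (if d.D x ≠ θ then 1 else 0) + c * d.N x

theorem measurable_loss (d : AdaptiveDesign M T 𝓧) (c : ℝ≥0∞) (θ : Fin 2) :
    Measurable (d.loss c θ) := by
  unfold loss
  refine Measurable.add ?_ (measurable_const.mul ?_)
  · exact (measurable_from_top (f := fun a : Fin 2 => if a ≠ θ then (1 : ℝ≥0∞) else 0)).comp
      d.measurable_D
  · exact (measurable_from_top (f := fun n : ℕ => (n : ℝ≥0∞))).comp d.measurable_N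

/-- The expected loss when the labels `0` and `1` carry the weights `a` and `b`. -/
noncomputable def weightedRisk (R : ResponseModel M 𝓧) (c : ℝ≥0∞) (d : AdaptiveDesign M T 𝓧)
    (a b : ℝ≥0∞) : ℝ≥0∞ :=
  a * ∫⁻ x, d.loss c 0 x ∂(d.law R 0) + b * ∫⁻ x, d.loss c 1 x ∂(d.law R 1)

theorem isProbabilityMeasure_law (R : ResponseModel M 𝓧) (d : AdaptiveDesign M T 𝓧) (θ : Fin 2) :
    IsProbabilityMeasure (d.law R θ) :=
  R.isProbabilityMeasure_adaptedLaw θ d.measurable_J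

/-- The design that remains after the first response `x₀`, if it is certain that a first response
is collected. -/
def tail (d : AdaptiveDesign M (T + 1) 𝓧) (hN : ∀ x, d.N x ≠ 0) (x₀ : 𝓧) :
    AdaptiveDesign M T 𝓧 where
  J := ResponseModel.tailRule d.J x₀
  measurable_J := ResponseModel.measurable_tailRule d.measurable_J x₀
  N y := d.N (Fin.cons x₀ y) - 1
  N_le y := by have := d.N_le (Fin.cons x₀ y); omega
  measurableSet_N n h := by
    obtain ⟨B, hB, hB'⟩ := d.measurableSet_N (n + 1) (by omega)
    refine ⟨_, measurable_finCons_right x₀ hB, ?_⟩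
    ext y
    have h1 : (Fin.cons x₀ y : Fin (T + 1) → 𝓧) ∈ firstResponses (by omega) ⁻¹' B
      ↔ d.N (Fin.cons x₀ y) = n + 1 := by rw [hB']; rfl
    have h2 := hN (Fin.cons x₀ y)
    rw [mem_preimage, firstResponses_cons h] at h1
    rw [mem_preimage, mem_preimage, h1, mem_ofPred_eq]
    omega
  D y := d.D (Fin.cons x₀ y)
  measurableSet_D n h a := by
    obtain ⟨B, hB, hB'⟩ := d.measurableSet_D (n + 1) (by omega) a
    refine ⟨_, measurable_finCons_right x₀ hB, ?_⟩
    ext y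
    have h1 : (Fin.cons x₀ y : Fin (T + 1) → 𝓧) ∈ firstResponses (by omega) ⁻¹' B
      ↔ d.N (Fin.cons x₀ y) = n + 1 ∧ d.D (Fin.cons x₀ y) = a := by rw [hB']; rfl
    have h2 := hN (Fin.cons x₀ y)
    rw [mem_preimage, firstResponses_cons h] at h1
    rw [mem_preimage, mem_preimage, h1, mem_ofPred_eq]
    refine and_congr_left fun _ => ?_
    omega

theorem loss_cons (d : AdaptiveDesign M (T + 1) 𝓧) (hN : ∀ x, d.N x ≠ 0) (c : ℝ≥0∞) (θ : Fin 2)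
    (x₀ : 𝓧) (y : Fin T → 𝓧) :
    d.loss c θ (Fin.cons x₀ y) = (d.tail hN x₀).loss c θ y + c := by
  have h : d.N (Fin.cons x₀ y) = (d.tail hN x₀).N y + 1 :=
    (Nat.succ_pred_eq_of_ne_zero (hN _)).symm
  have h' : d.D (Fin.cons x₀ y) = (d.tail hN x₀).D y := rfl
  simp only [loss, h, h']
  push_cast
  ring

theorem lintegral_loss_succ (R : ResponseModel M 𝓧) (d : AdaptiveDesign M (T + 1) 𝓧)
    (hN : ∀ x, d.N x ≠ 0) (c : ℝ≥0∞) (θ : Fin 2) :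
    ∫⁻ x, d.loss c θ x ∂(d.law R θ)
      = (∫⁻ x₀, (R.f θ (d.J 0 noResponses) x₀ : ℝ≥0∞)
          * ∫⁻ y, (d.tail hN x₀).loss c θ y ∂((d.tail hN x₀).law R θ) ∂(R.ν)) + c := by
  have h1 (x₀ : 𝓧) : ∫⁻ y, d.loss c θ (Fin.cons x₀ y) ∂((d.tail hN x₀).law R θ)
      = (∫⁻ y, (d.tail hN x₀).loss c θ y ∂((d.tail hN x₀).law R θ)) + c := by
    have := (d.tail hN x₀).isProbabilityMeasure_law R θ
    simp_rw [d.loss_cons hN]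
    rw [lintegral_add_right _ measurable_const]
    simp
  refine (R.lintegral_adaptedLaw_succ θ d.measurable_J (d.measurable_loss c θ)).trans ?_
  calc _ = ∫⁻ x₀, ((R.f θ (d.J 0 noResponses) x₀ : ℝ≥0∞)
          * ∫⁻ y, (d.tail hN x₀).loss c θ y ∂((d.tail hN x₀).law R θ)
          + c * (R.f θ (d.J 0 noResponses) x₀ : ℝ≥0∞)) ∂(R.ν) :=
        lintegral_congr fun x₀ => by
          refine (congrArg _ (h1 x₀)).trans ?_
          ring
    _ = _ := by
        rw [lintegral_add_right _ (by fun_prop), R.lintegral_weight]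

theorem measurable_lintegral_loss_tail (R : ResponseModel M 𝓧) (d : AdaptiveDesign M (T + 1) 𝓧)
    (hN : ∀ x, d.N x ≠ 0) (c : ℝ≥0∞) (θ : Fin 2) :
    Measurable fun x₀ => ∫⁻ y, (d.tail hN x₀).loss c θ y ∂((d.tail hN x₀).law R θ) := by
  -- The loss of the remaining design, read as a function of the whole sequence; the `- 1` is the
  -- response already collected.
  have hg : Measurable fun x => (if d.D x ≠ θ then 1 else 0) + c * (d.N x - 1 : ℕ) := by
    refine Measurable.add ?_ (measurable_const.mul ?_)
    · exact (measurable_from_top (f := fun a : Fin 2 => if a ≠ θ then (1 : ℝ≥0∞) else 0)).comp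
        d.measurable_D
    · exact (measurable_from_top (f := fun n : ℕ => ((n - 1 : ℕ) : ℝ≥0∞))).comp d.measurable_N
  exact R.measurable_lintegral_tailRule θ d.measurable_J hg

/-- The risk of a design satisfies the recursion of `contRisk`, with the risk of the remaining
design at the updated weights in place of the optimal value. -/
theorem weightedRisk_succ (R : ResponseModel M 𝓧) (d : AdaptiveDesign M (T + 1) 𝓧)
    (hN : ∀ x, d.N x ≠ 0) (c a b : ℝ≥0∞) :
    d.weightedRisk R c a b = (∫⁻ x₀, (d.tail hN x₀).weightedRisk R c
      (a * R.f 0 (d.J 0 noResponses) x₀) (b * R.f 1 (d.J 0 noResponses) x₀) ∂(R.ν))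
        + c * (a + b) := by
  have h (θ) := d.measurable_lintegral_loss_tail R hN c θ
  have h' (θ) : Measurable fun x₀ => (R.f θ (d.J 0 noResponses) x₀ : ℝ≥0∞)
      * ∫⁻ y, (d.tail hN x₀).loss c θ y ∂((d.tail hN x₀).law R θ) :=
    (R.measurable_f θ _).coe_nnreal_ennreal.mul (h θ)
  simp only [weightedRisk, mul_assoc]
  rw [lintegral_add_left ((h' 0).const_mul a), lintegral_const_mul _ (h' 0),
    lintegral_const_mul _ (h' 1),
    lintegral_loss_succ R d hN, lintegral_loss_succ R d hN]
  ring

/-- Before any response the `σ`-algebra is trivial, as `Fin 0 → 𝓧` is a single point. A design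
therefore either stops at once on every path with one fixed decision, or collects a first response
on every path. -/
theorem exists_eq_of_N_eq_zero (d : AdaptiveDesign M T 𝓧) {x₁ : Fin T → 𝓧} (hx : d.N x₁ = 0) :
    (∀ x, d.N x = 0) ∧ ∃ a, ∀ x, d.D x = a := by
  refine ⟨fun x => ?_, d.D x₁, fun x => ?_⟩
  · obtain ⟨B, -, hB⟩ := d.measurableSet_N 0 (Nat.zero_le T)
    have h1 : x₁ ∈ firstResponses (Nat.zero_le T) ⁻¹' B := by rw [hB]; exact hx
    have h2 : x ∈ firstResponses (Nat.zero_le T) ⁻¹' B := by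
      rw [mem_preimage] at h1 ⊢
      rwa [Subsingleton.elim (firstResponses _ x) (firstResponses _ x₁)]
    rw [hB] at h2
    exact h2
  · obtain ⟨B, -, hB⟩ := d.measurableSet_D 0 (Nat.zero_le T) (d.D x₁)
    have h1 : x₁ ∈ firstResponses (Nat.zero_le T) ⁻¹' B := by rw [hB]; exact ⟨hx, rfl⟩
    have h2 : x ∈ firstResponses (Nat.zero_le T) ⁻¹' B := by
      rw [mem_preimage] at h1 ⊢
      rwa [Subsingleton.elim (firstResponses _ x) (firstResponses _ x₁)]
    rw [hB] at h2
    exact h2.2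

theorem weightedRisk_of_N_eq_zero (R : ResponseModel M 𝓧) (d : AdaptiveDesign M T 𝓧)
    (hN : ∀ x, d.N x = 0) {a₀ : Fin 2} (hD : ∀ x, d.D x = a₀) (c a b : ℝ≥0∞) :
    d.weightedRisk R c a b = if a₀ = 1 then a else b := by
  have h0 := d.isProbabilityMeasure_law R 0
  have h1 := d.isProbabilityMeasure_law R 1
  fin_cases a₀ <;> simp [weightedRisk, loss, hN, hD]

/-- Backward induction bounds the weighted risk of every adaptive design from below. -/
theorem optRisk_le_weightedRisk (R : ResponseModel M 𝓧) (c : ℝ≥0∞) (d : AdaptiveDesign M T 𝓧)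
    (a b : ℝ≥0∞) : R.optRisk c T a b ≤ d.weightedRisk R c a b := by
  induction T generalizing a b with
  | zero =>
    obtain ⟨hN, a₀, hD⟩ := d.exists_eq_of_N_eq_zero (x₁ := Fin.elim0) (Nat.le_zero.1 (d.N_le _))
    rw [d.weightedRisk_of_N_eq_zero R hN hD]
    refine (R.optRisk_le_min c _ a b).trans ?_
    split_ifs
    exacts [min_le_left _ _, min_le_right _ _]
  | succ T ih =>
    by_cases h : ∃ x, d.N x = 0
    · obtain ⟨x, hx⟩ := h
      obtain ⟨hN, a₀, hD⟩ := d.exists_eq_of_N_eq_zero hx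
      rw [d.weightedRisk_of_N_eq_zero R hN hD]
      refine (R.optRisk_le_min c _ a b).trans ?_
      split_ifs
      exacts [min_le_left _ _, min_le_right _ _]
    · have hN : ∀ x, d.N x ≠ 0 := fun x hx => h ⟨x, hx⟩
      rw [d.weightedRisk_succ R hN, ResponseModel.optRisk_succ]
      refine (min_le_left _ _).trans ((iInf_le _ (d.J 0 noResponses)).trans ?_)
      rw [ResponseModel.contRisk]
      gcongr with x
      exact ih _ _ _

end AdaptiveDesign

/-! ### Policies that depend on the log-likelihood ratio only -/

theorem Nat.sInf_eq_iff_of_nonempty {S : Set ℕ} (hS : S.Nonempty) {n : ℕ} :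
    sInf S = n ↔ n ∈ S ∧ ∀ k < n, k ∉ S := by
  constructor
  · rintro rfl
    exact ⟨Nat.sInf_mem hS, fun k hk => Nat.notMem_of_lt_sInf hk⟩
  · rintro ⟨h1, h2⟩
    exact le_antisymm (Nat.sInf_le h1) (not_lt.1 fun h => h2 _ h (Nat.sInf_mem hS))

section PolicyLLR

variable {M T : ℕ} {𝓧 : Type*} [MeasurableSpace 𝓧] (R : ResponseModel M 𝓧)

/-- The log-likelihood ratio after `n` responses, started at `l`, when `sel` selects the
experiments. -/
noncomputable def policyLLR (sel : ℕ → EReal → Fin M) (l : EReal) (x : Fin T → 𝓧) : ℕ → EReal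
  | 0 => l
  | n + 1 =>
    if h : n < T then
      policyLLR sel l x n + R.logRatio (sel n (policyLLR sel l x n)) (x ⟨n, h⟩)
    else policyLLR sel l x n

theorem sprtLLR_eq_policyLLR (j : ℝ → ℕ → EReal → Fin M) (p : ℝ) (x : Fin T → 𝓧) (n : ℕ) :
    sprtLLR R j p x n = policyLLR R (j p) 0 x n := by
  induction n with
  | zero => rfl
  | succ n ih => simp only [sprtLLR, policyLLR, ih]

/-- The recursion does not look ahead; this makes policies adapted. -/
theorem policyLLR_firstResponses (sel : ℕ → EReal → Fin M) (l : EReal) {n : ℕ} (h : n ≤ T)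
    (x : Fin T → 𝓧) {k : ℕ} (hk : k ≤ n) :
    policyLLR R sel l (firstResponses h x) k = policyLLR R sel l x k := by
  induction k with
  | zero => rfl
  | succ k ih =>
    simp only [policyLLR, ih (by omega)]
    rw [dif_pos (by omega), dif_pos (by omega)]
    rfl

/-- An arbitrary starting value `l` is what allows the first response to be absorbed into the start,
so that induction on the horizon works. -/
theorem policyLLR_cons (sel : ℕ → EReal → Fin M) (l : EReal) (x₀ : 𝓧) (y : Fin T → 𝓧) (k : ℕ) :
    policyLLR R sel l (Fin.cons x₀ y : Fin (T + 1) → 𝓧) (k + 1)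
      = policyLLR R (fun n => sel (n + 1)) (l + R.logRatio (sel 0 l) x₀) y k := by
  induction k with
  | zero =>
    simp only [policyLLR]
    rw [dif_pos (Nat.succ_pos T)]
    rfl
  | succ k ih =>
    rw [policyLLR, ih]
    simp only [policyLLR]
    by_cases h : k < T
    · rw [dif_pos (by omega), dif_pos h]
      rfl
    · rw [dif_neg (by omega), dif_neg h]

theorem measurable_policyLLR {α : Type*} [MeasurableSpace α] {sel : α → ℕ → EReal → Fin M}
    (hsel : ∀ n < T, Measurable fun q : α × EReal => sel q.1 n q.2) {x : α → Fin T → 𝓧}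
    (hx : Measurable x) (l : EReal) (n : ℕ) :
    Measurable fun a => policyLLR R (sel a) l (x a) n := by
  induction n with
  | zero => exact measurable_const
  | succ n ih =>
    simp only [policyLLR]
    by_cases h : n < T
    · simp only [dif_pos h]
      have h2 : Measurable fun q : Fin M × 𝓧 => R.logRatio q.1 q.2 :=
        measurable_from_prod_countable_right fun δ => R.measurable_logRatio δ
      exact ih.add (h2.comp (((hsel n h).comp (measurable_id.prodMk ih)).prodMk
        ((measurable_pi_apply _).comp hx)))
    · simpa only [dif_neg h] using ih

end PolicyLLR

/-- A design with at most `T` responses whose actions depend on the number of responses and the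
log-likelihood ratio only. -/
structure MarkovPolicy (M T : ℕ) where
  sel : ℕ → EReal → Fin M
  measurable_sel : ∀ n < T, Measurable (sel n)
  halt : ℕ → Set EReal
  measurableSet_halt : ∀ n ≤ T, MeasurableSet (halt n)
  halt_last : halt T = univ
  up : ℕ → Set EReal
  measurableSet_up : ∀ n ≤ T, MeasurableSet (up n)

namespace MarkovPolicy

variable {M T : ℕ} {𝓧 : Type*} [MeasurableSpace 𝓧] (R : ResponseModel M 𝓧)

/-- The number of responses. -/
noncomputable def time (P : MarkovPolicy M T) (l : EReal) (x : Fin T → 𝓧) : ℕ :=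
  sInf {n | policyLLR R P.sel l x n ∈ P.halt n}

open Classical in
/-- The decision. -/
noncomputable def decision (P : MarkovPolicy M T) (l : EReal) (x : Fin T → 𝓧) : Fin 2 :=
  if policyLLR R P.sel l x (P.time R l x) ∈ P.up (P.time R l x) then 1 else 0

theorem halt_nonempty (P : MarkovPolicy M T) (l : EReal) (x : Fin T → 𝓧) :
    {n | policyLLR R P.sel l x n ∈ P.halt n}.Nonempty :=
  ⟨T, by simp [P.halt_last]⟩

theorem time_le (P : MarkovPolicy M T) (l : EReal) (x : Fin T → 𝓧) : P.time R l x ≤ T :=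
  Nat.sInf_le (by simp [P.halt_last])

theorem time_eq_iff (P : MarkovPolicy M T) (l : EReal) (x : Fin T → 𝓧) (n : ℕ) :
    P.time R l x = n ↔ policyLLR R P.sel l x n ∈ P.halt n ∧
      ∀ k < n, policyLLR R P.sel l x k ∉ P.halt k :=
  Nat.sInf_eq_iff_of_nonempty (P.halt_nonempty R l x)

theorem measurable_policyLLR_sel (P : MarkovPolicy M T) (l : EReal) {n : ℕ} (h : n ≤ T) (k : ℕ) :
    Measurable fun z : Fin n → 𝓧 => policyLLR R P.sel l z k :=
  measurable_policyLLR R (sel := fun _ => P.sel)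
    (fun m hm => (P.measurable_sel m (by omega)).comp measurable_snd) measurable_id l k

theorem measurableSet_time (P : MarkovPolicy M T) (l : EReal) {n : ℕ} (h : n ≤ T) :
    MeasurableSet {z : Fin n → 𝓧 | policyLLR R P.sel l z n ∈ P.halt n ∧
      ∀ k < n, policyLLR R P.sel l z k ∉ P.halt k} := by
  refine MeasurableSet.inter (P.measurable_policyLLR_sel R l h n (P.measurableSet_halt n h)) ?_
  have : {z : Fin n → 𝓧 | ∀ k < n, policyLLR R P.sel l z k ∉ P.halt k}
      = ⋂ k, ⋂ (_ : k < n), {z | policyLLR R P.sel l z k ∈ P.halt k}ᶜ := by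
    ext z; simp
  change MeasurableSet {z : Fin n → 𝓧 | ∀ k < n, policyLLR R P.sel l z k ∉ P.halt k}
  rw [this]
  exact MeasurableSet.iInter fun k => MeasurableSet.iInter fun hk =>
    (P.measurable_policyLLR_sel R l h k (P.measurableSet_halt k (by omega))).compl

theorem time_eq_iff_firstResponses (P : MarkovPolicy M T) (l : EReal) (x : Fin T → 𝓧) {n : ℕ}
    (h : n ≤ T) :
    P.time R l x = n ↔ policyLLR R P.sel l (firstResponses h x) n ∈ P.halt n ∧
      ∀ k < n, policyLLR R P.sel l (firstResponses h x) k ∉ P.halt k := by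
  rw [time_eq_iff, policyLLR_firstResponses R _ _ h x le_rfl]
  refine and_congr_right fun _ => forall₂_congr fun k hk => ?_
  rw [policyLLR_firstResponses R _ _ h x hk.le]

/-- The adaptive design that follows the policy `P` from the log-likelihood ratio `l`. -/
noncomputable def design (P : MarkovPolicy M T) (l : EReal) : AdaptiveDesign M T 𝓧 where
  J n z := P.sel n (policyLLR R P.sel l z n)
  measurable_J n :=
    (P.measurable_sel n n.isLt).comp (P.measurable_policyLLR_sel R l n.isLt.le n)
  N := P.time R l
  N_le := P.time_le R l
  measurableSet_N n h := by
    refine ⟨_, P.measurableSet_time R l h, ?_⟩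
    ext x
    exact (P.time_eq_iff_firstResponses R l x h).symm
  D := P.decision R l
  measurableSet_D n h a := by
    have hup := P.measurable_policyLLR_sel R l h n (P.measurableSet_up n h)
    refine ⟨{z | policyLLR R P.sel l z n ∈ P.halt n ∧
      ∀ k < n, policyLLR R P.sel l z k ∉ P.halt k}
        ∩ (if a = 1 then {z | policyLLR R P.sel l z n ∈ P.up n}
          else {z | policyLLR R P.sel l z n ∈ P.up n}ᶜ), ?_, ?_⟩
    · refine (P.measurableSet_time R l h).inter ?_
      split_ifs
      exacts [hup, hup.compl]
    · ext x
      refine and_congr (P.time_eq_iff_firstResponses R l x h).symm Iff.rfl |>.trans ?_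
      refine and_congr_right fun hx => ?_
      rw [decision, hx]
      have := policyLLR_firstResponses R P.sel l h x le_rfl
      by_cases hu : policyLLR R P.sel l x n ∈ P.up n
      · fin_cases a <;> simp [hu, this]
      · fin_cases a <;> simp [hu, this]

/-- The policy from the second response on. -/
def shift (P : MarkovPolicy M (T + 1)) : MarkovPolicy M T where
  sel n := P.sel (n + 1)
  measurable_sel n h := P.measurable_sel (n + 1) (by omega)
  halt n := P.halt (n + 1)
  measurableSet_halt n h := P.measurableSet_halt (n + 1) (by omega)
  halt_last := P.halt_last
  up n := P.up (n + 1)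
  measurableSet_up n h := P.measurableSet_up (n + 1) (by omega)

theorem time_cons (P : MarkovPolicy M (T + 1)) {l : EReal} (hl : l ∉ P.halt 0) (x₀ : 𝓧)
    (y : Fin T → 𝓧) :
    P.time R l (Fin.cons x₀ y : Fin (T + 1) → 𝓧)
      = P.shift.time R (l + R.logRatio (P.sel 0 l) x₀) y + 1 := by
  rw [time_eq_iff]
  obtain ⟨h1, h2⟩ := (P.shift.time_eq_iff R (l + R.logRatio (P.sel 0 l) x₀) y _).1 rfl
  refine ⟨?_, fun k hk => ?_⟩
  · rw [policyLLR_cons]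
    exact h1
  · cases k with
    | zero => exact hl
    | succ k =>
      rw [policyLLR_cons]
      exact h2 k (by omega)

theorem decision_cons (P : MarkovPolicy M (T + 1)) {l : EReal} (hl : l ∉ P.halt 0) (x₀ : 𝓧)
    (y : Fin T → 𝓧) :
    P.decision R l (Fin.cons x₀ y : Fin (T + 1) → 𝓧)
      = P.shift.decision R (l + R.logRatio (P.sel 0 l) x₀) y := by
  rw [decision, decision, P.time_cons R hl, policyLLR_cons]
  rfl

theorem design_N_ne_zero (P : MarkovPolicy M T) {l : EReal} (hl : l ∉ P.halt 0) (x : Fin T → 𝓧) :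
    (P.design R l).N x ≠ 0 := fun h =>
  hl ((P.time_eq_iff R l x 0).1 h).1

/-- The Markov property: after a first response the policy is restarted at the updated ratio, with
the stage index shifted by one. -/
theorem design_tail (P : MarkovPolicy M (T + 1)) {l : EReal} (hl : l ∉ P.halt 0) (x₀ : 𝓧) :
    (P.design R l).tail (P.design_N_ne_zero R hl) x₀
      = P.shift.design R (l + R.logRatio (P.sel 0 l) x₀) := by
  have hJ : ((P.design R l).tail (P.design_N_ne_zero R hl) x₀).J
      = (P.shift.design R (l + R.logRatio (P.sel 0 l) x₀)).J :=
    funext fun n => funext fun z =>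
      congrArg (P.sel (n + 1)) (policyLLR_cons R P.sel l x₀ z n)
  have hN : ((P.design R l).tail (P.design_N_ne_zero R hl) x₀).N
      = (P.shift.design R (l + R.logRatio (P.sel 0 l) x₀)).N :=
    funext fun y => by
      have := P.time_cons R hl x₀ y
      exact Nat.sub_eq_of_eq_add this
  have hD : ((P.design R l).tail (P.design_N_ne_zero R hl) x₀).D
      = (P.shift.design R (l + R.logRatio (P.sel 0 l) x₀)).D :=
    funext fun y => P.decision_cons R hl x₀ y
  -- The two designs agree in `J`, `N` and `D`; their remaining fields are proofs.
  cases h1 : (P.design R l).tail (P.design_N_ne_zero R hl) x₀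
  cases h2 : P.shift.design R (l + R.logRatio (P.sel 0 l) x₀)
  rw [h1, h2] at hJ hN hD
  simp only at hJ hN hD
  subst hJ hN hD
  rfl

open Classical in
/-- The actions of the policy attain the minima of backward induction with the prior `p`. -/
structure IsOptimal (P : MarkovPolicy M T) (c : ℝ≥0∞) (p : ℝ) : Prop where
  halt : ∀ n k, n + k = T → ∀ l ∈ P.halt n,
    (if l ∈ P.up n then post0 p l else post1 p l) ≤ R.optRisk c k (post0 p l) (post1 p l)
  cont : ∀ n k, n + (k + 1) = T → ∀ l ∉ P.halt n,
    R.contRisk c k (post0 p l) (post1 p l) (P.sel n l)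
      ≤ R.optRisk c (k + 1) (post0 p l) (post1 p l)

theorem IsOptimal.shift {R : ResponseModel M 𝓧} {P : MarkovPolicy M (T + 1)} {c : ℝ≥0∞} {p : ℝ}
    (h : P.IsOptimal R c p) : P.shift.IsOptimal R c p :=
  ⟨fun n k hnk => h.halt (n + 1) k (by omega), fun n k hnk => h.cont (n + 1) k (by omega)⟩

theorem weightedRisk_of_mem_halt (P : MarkovPolicy M T) {c : ℝ≥0∞} {p : ℝ}
    (h : P.IsOptimal R c p) {l : EReal} (hl : l ∈ P.halt 0) {s : ℝ≥0∞} (hs : s ≠ ∞) :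
    (P.design R l).weightedRisk R c (s * post0 p l) (s * post1 p l)
      ≤ R.optRisk c T (s * post0 p l) (s * post1 p l) := by
  classical
  have hN (x : Fin T → 𝓧) : (P.design R l).N x = 0 := (P.time_eq_iff R l x 0).2 ⟨hl, by simp⟩
  have hD (x : Fin T → 𝓧) : (P.design R l).D x = if l ∈ P.up 0 then 1 else 0 := by
    have h0 : P.time R l x = 0 := hN x
    change P.decision R l x = _
    rw [decision, h0]
    rfl
  rw [(P.design R l).weightedRisk_of_N_eq_zero R hN hD, R.optRisk_mul c T hs]
  refine le_trans ?_ (mul_le_mul_right (h.halt 0 T (by omega) l hl) s)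
  split_ifs <;> simp_all

/-- The verification half of dynamic programming. The scale `s` collects the predictive densities of
the responses seen so far; with it, weights of the form `(s * post0, s * post1)` keep this form
after each response, and the induction closes. -/
theorem weightedRisk_design_le (P : MarkovPolicy M T) {c : ℝ≥0∞} {p : ℝ}
    (h : P.IsOptimal R c p) (l : EReal) {s : ℝ≥0∞} (hs : s ≠ ∞) :
    (P.design R l).weightedRisk R c (s * post0 p l) (s * post1 p l)
      ≤ R.optRisk c T (s * post0 p l) (s * post1 p l) := by
  induction T generalizing l s with
  | zero => exact P.weightedRisk_of_mem_halt R h (by simp [P.halt_last]) hs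
  | succ T ih =>
    by_cases hl : l ∈ P.halt 0
    · exact P.weightedRisk_of_mem_halt R h hl hs
    rw [(P.design R l).weightedRisk_succ R (P.design_N_ne_zero R hl), R.optRisk_mul c _ hs]
    refine le_trans ?_ (mul_le_mul_right (h.cont 0 T (by omega) l hl) s)
    rw [← R.contRisk_mul c T hs, ResponseModel.contRisk]
    have hJ : (P.design R l).J 0 noResponses = P.sel 0 l := rfl
    gcongr with x
    rw [hJ, P.design_tail R hl]
    -- Bayes' formula: the scale is multiplied by the predictive density and the posterior is
    -- updated.
    have h0 : s * post0 p l * R.f 0 (P.sel 0 l) x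
        = s * (post0 p l * R.f 0 (P.sel 0 l) x + post1 p l * R.f 1 (P.sel 0 l) x)
          * post0 p (l + R.logRatio (P.sel 0 l) x) := by
      rw [mul_assoc, mul_assoc, R.post0_update]
    have h1 : s * post1 p l * R.f 1 (P.sel 0 l) x
        = s * (post0 p l * R.f 0 (P.sel 0 l) x + post1 p l * R.f 1 (P.sel 0 l) x)
          * post1 p (l + R.logRatio (P.sel 0 l) x) := by
      rw [mul_assoc, mul_assoc, R.post1_update]
    rw [h0, h1]
    exact ih P.shift h.shift _ (ENNReal.mul_ne_top hs (ENNReal.add_ne_top.2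
      ⟨ENNReal.mul_ne_top (post0_ne_top p l) ENNReal.coe_ne_top,
        ENNReal.mul_ne_top (post1_ne_top p l) ENNReal.coe_ne_top⟩))

end MarkovPolicy

/-! ### Monotonicity and continuity of the posterior -/

section Posterior

variable {p : ℝ}

theorem continuous_post0 : Continuous (post0 p) := by
  have h1 : Continuous fun l : EReal => ENNReal.ofReal p * EReal.exp l :=
    (ENNReal.continuous_const_mul ENNReal.ofReal_ne_top).comp ENNReal.continuous_exp
  have h2 : Continuous fun l : EReal =>
      (ENNReal.ofReal (1 - p) + ENNReal.ofReal p * EReal.exp l)⁻¹ :=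
    continuous_inv.comp (continuous_const.add h1)
  exact (ENNReal.continuous_const_mul ENNReal.ofReal_ne_top).comp h2

theorem continuous_post1 : Continuous (post1 p) :=
  (ENNReal.continuous_sub_left ENNReal.one_ne_top).comp continuous_post0

theorem post0_antitone : Antitone (post0 p) := fun l r h => by
  have := EReal.exp_monotone h
  unfold post0
  gcongr

theorem post1_monotone : Monotone (post1 p) := fun _ _ h => tsub_le_tsub_left (post0_antitone h) 1

theorem post0_top (hp : p ∈ Ioo (0 : ℝ) 1) : post0 p ⊤ = 0 := by
  have : ENNReal.ofReal p ≠ 0 := by simpa using hp.1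
  simp [post0, ENNReal.mul_top this]

theorem post1_bot (hp : p ∈ Ioo (0 : ℝ) 1) : post1 p ⊥ = 0 := by
  have : ENNReal.ofReal (1 - p) ≠ 0 := by simpa using hp.2
  simp [post1, post0, ENNReal.div_self this]

/-- The posteriors have a common denominator, so the comparison is between `1 - p` and `p * exp l`.
-/
theorem post_compare (hp : p ∈ Ioo (0 : ℝ) 1) (l : EReal) :
    (logPriorOdds p ≤ l ↔ post0 p l ≤ post1 p l) ∧
      (l ≤ logPriorOdds p ↔ post1 p l ≤ post0 p l) := by
  have ha : ENNReal.ofReal (1 - p) ≠ 0 := by simpa using hp.2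
  have hb : ENNReal.ofReal p ≠ 0 := by simpa using hp.1
  have hodds : EReal.exp (logPriorOdds p) = ENNReal.ofReal (1 - p) / ENNReal.ofReal p :=
    ENNReal.exp_log _
  rw [← EReal.exp_le_exp_iff, ← EReal.exp_le_exp_iff, hodds, post1, post0]
  have ha' : ENNReal.ofReal (1 - p) ≠ ∞ := ENNReal.ofReal_ne_top
  have hb' : ENNReal.ofReal p ≠ ∞ := ENNReal.ofReal_ne_top
  revert ha hb ha' hb'
  generalize ENNReal.ofReal (1 - p) = a
  generalize ENNReal.ofReal p = b
  generalize EReal.exp l = e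
  intro ha hb ha' hb'
  rcases eq_or_ne e ∞ with rfl | he
  · have h1 : a / b ≠ ∞ := ENNReal.div_ne_top ha' hb
    simp [ENNReal.mul_top hb, h1]
  lift a to ℝ≥0 using ha'
  lift b to ℝ≥0 using hb'
  lift e to ℝ≥0 using he
  have ha0 : 0 < a := pos_iff_ne_zero.2 (by simpa using ha)
  have hb0 : 0 < b := pos_iff_ne_zero.2 (by simpa using hb)
  have hs : 0 < a + b * e := by positivity
  have h3 : 1 - a / (a + b * e) = b * e / (a + b * e) := by
    refine tsub_eq_of_eq_add ?_
    field_simp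
    ring
  norm_cast
  rw [← ENNReal.coe_div hb0.ne', ← ENNReal.coe_div hs.ne']
  norm_cast
  rw [h3, div_le_div_iff_of_pos_right hs, div_le_div_iff_of_pos_right hs, div_le_iff₀ hb0,
    le_div_iff₀ hb0, mul_comm e b]
  exact ⟨Iff.rfl, Iff.rfl⟩

end Posterior

/-! ### Shape of the continuation sets and optimality at the boundaries -/

namespace ResponseModel

variable {M : ℕ} {𝓧 : Type*} [MeasurableSpace 𝓧] (R : ResponseModel M 𝓧)

theorem contRisk_mono (c : ℝ≥0∞) (k : ℕ) {a b a' b' : ℝ≥0∞} (ha : a ≤ a') (hb : b ≤ b')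
    (δ : Fin M) : R.contRisk c k a b δ ≤ R.contRisk c k a' b' δ := by
  have h := R.contRisk_superadd c k a b (a' - a) (b' - b) δ
  rw [add_tsub_cancel_of_le ha, add_tsub_cancel_of_le hb] at h
  exact le_self_add.trans h

/-- The least expected loss when at least one more response is collected. -/
noncomputable def minContRisk (c : ℝ≥0∞) (k : ℕ) (a b : ℝ≥0∞) : ℝ≥0∞ := ⨅ δ, R.contRisk c k a b δ

theorem measurable_minContRisk (c : ℝ≥0∞) (k : ℕ) :
    Measurable (fun q : ℝ≥0∞ × ℝ≥0∞ => R.minContRisk c k q.1 q.2) :=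
  Measurable.iInf fun δ => R.measurable_contRisk c k δ

theorem minContRisk_mono (c : ℝ≥0∞) (k : ℕ) {a b a' b' : ℝ≥0∞} (ha : a ≤ a') (hb : b ≤ b') :
    R.minContRisk c k a b ≤ R.minContRisk c k a' b' :=
  iInf_mono fun δ => R.contRisk_mono c k ha hb δ

theorem minContRisk_mul (c : ℝ≥0∞) (k : ℕ) {s : ℝ≥0∞} (hs : s ≠ ∞) (hs0 : s ≠ 0) (a b : ℝ≥0∞) :
    R.minContRisk c k (s * a) (s * b) = s * R.minContRisk c k a b := by
  rw [minContRisk, minContRisk, ENNReal.mul_iInf_of_ne hs0 hs]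
  exact iInf_congr fun δ => R.contRisk_mul c k hs a b δ

theorem minContRisk_add_le (c : ℝ≥0∞) (k : ℕ) (a b s t : ℝ≥0∞) :
    R.minContRisk c k (a + s) (b + t) ≤ R.minContRisk c k a b + (1 + k * c + c) * (s + t) := by
  rw [minContRisk, minContRisk, ENNReal.iInf_add]
  exact iInf_mono fun δ => R.contRisk_add_le c k a b s t δ

theorem le_minContRisk (c : ℝ≥0∞) (k : ℕ) (a b : ℝ≥0∞) : c * (a + b) ≤ R.minContRisk c k a b :=
  le_iInf fun δ => R.le_contRisk c k a b δ

theorem minContRisk_zero_cost_le [Nonempty (Fin M)] (k : ℕ) (a b : ℝ≥0∞) :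
    R.minContRisk 0 k a b ≤ min a b :=
  (iInf_le _ (Classical.arbitrary _)).trans (R.contRisk_zero_cost_le k a b _)

section Boundary

variable [Nonempty (Fin M)] {c p : ℝ} {T k n : ℕ}

/-- Above the log prior odds stopping costs `post0`. Scaling the weights at `r` by `t = post0 l /
post0 r ≤ 1` gives first weight `post0 l` and second weight at most `post1 l`. Homogeneity and
monotonicity then bound `t` times the continuation risk at `r` by that at `l`, hence by `post0 l = t
* post0 r`. -/
theorem contSet_of_le_of_logPriorOdds_le (hc : 0 ≤ c) (hp : p ∈ Ioo (0 : ℝ) 1)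
    (hkn : n + (k + 1) = T) {l r : EReal} (hl : l ∈ contSet R c p T n) (hr : logPriorOdds p ≤ r)
    (hrl : r ≤ l) : r ∈ contSet R c p T n := by
  rw [mem_contSet_iff R hc p hkn] at hl ⊢
  change R.minContRisk _ _ _ _ ≤ _ at hl ⊢
  -- If `post0 l = 0`, stopping is free at `l`, so continuing there can only be as good when `c =
  -- 0`; then continuing is never worse anywhere.
  rcases eq_or_ne (post0 p l) 0 with h0 | h0
  · have h1 := (R.le_minContRisk (ENNReal.ofReal c) k _ _).trans (hl.trans (min_le_left _ _))
    rw [post0_add_post1, h0, mul_one, nonpos_iff_eq_zero] at h1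
    rw [h1]
    exact R.minContRisk_zero_cost_le k _ _
  have hu0 : post0 p r ≠ 0 := (lt_of_lt_of_le (pos_iff_ne_zero.2 h0) (post0_antitone hrl)).ne'
  have hur := post0_ne_top p r
  set t := post0 p l / post0 p r with ht
  have ht1 : t ≤ 1 := ENNReal.div_le_of_le_mul (by rw [one_mul]; exact post0_antitone hrl)
  have htt : t ≠ ∞ := ne_top_of_le_ne_top ENNReal.one_ne_top ht1
  have ht0 : t ≠ 0 := ENNReal.div_ne_zero.2 ⟨h0, hur⟩
  have hmul : t * post0 p r = post0 p l := ENNReal.div_mul_cancel hu0 hur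
  rw [min_eq_left (((post_compare hp r).1).1 hr)]
  refine (ENNReal.mul_le_mul_iff_right ht0 htt).1 ?_
  rw [← R.minContRisk_mul _ k htt ht0, hmul]
  refine (R.minContRisk_mono _ k le_rfl ?_).trans (hl.trans (min_le_left _ _))
  exact (mul_le_mul' ht1 (post1_monotone hrl)).trans_eq (one_mul _)

theorem contSet_of_le_of_le_logPriorOdds (hc : 0 ≤ c) (hp : p ∈ Ioo (0 : ℝ) 1)
    (hkn : n + (k + 1) = T) {l r : EReal} (hl : l ∈ contSet R c p T n) (hr : r ≤ logPriorOdds p)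
    (hlr : l ≤ r) : r ∈ contSet R c p T n := by
  rw [mem_contSet_iff R hc p hkn] at hl ⊢
  change R.minContRisk _ _ _ _ ≤ _ at hl ⊢
  rcases eq_or_ne (post1 p l) 0 with h0 | h0
  · have h1 := (R.le_minContRisk (ENNReal.ofReal c) k _ _).trans (hl.trans (min_le_right _ _))
    rw [post0_add_post1, h0, mul_one, nonpos_iff_eq_zero] at h1
    rw [h1]
    exact R.minContRisk_zero_cost_le k _ _
  have hu0 : post1 p r ≠ 0 := (lt_of_lt_of_le (pos_iff_ne_zero.2 h0) (post1_monotone hlr)).ne'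
  have hur := post1_ne_top p r
  set t := post1 p l / post1 p r with ht
  have ht1 : t ≤ 1 := ENNReal.div_le_of_le_mul (by rw [one_mul]; exact post1_monotone hlr)
  have htt : t ≠ ∞ := ne_top_of_le_ne_top ENNReal.one_ne_top ht1
  have ht0 : t ≠ 0 := ENNReal.div_ne_zero.2 ⟨h0, hur⟩
  have hmul : t * post1 p r = post1 p l := ENNReal.div_mul_cancel hu0 hur
  rw [min_eq_right (((post_compare hp r).2).1 hr)]
  refine (ENNReal.mul_le_mul_iff_right ht0 htt).1 ?_
  rw [← R.minContRisk_mul _ k htt ht0, hmul]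
  refine (R.minContRisk_mono _ k ?_ le_rfl).trans (hl.trans (min_le_right _ _))
  exact (mul_le_mul' ht1 (post0_antitone hlr)).trans_eq (one_mul _)

/-- The test stops at the boundary itself, which may belong to the continuation set. Points `r > l`
lie outside that set, so stopping is better there; the inequality passes to the limit `r → l` from
the right because the continuation risk grows by at most a constant times `post1 r - post1 l`. At `l
= ⊤` no such `r` exists, but stopping is free. -/
theorem min_post_le_of_upperBoundary_le (hc : 0 ≤ c) (hp : p ∈ Ioo (0 : ℝ) 1)
    (hkn : n + (k + 1) = T) {l : EReal} (hl : upperBoundary R c p T n ≤ l) :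
    min (post0 p l) (post1 p l)
      ≤ R.minContRisk (ENNReal.ofReal c) k (post0 p l) (post1 p l) := by
  rcases eq_or_lt_of_le (le_top : l ≤ ⊤) with rfl | hlt
  · simp [post0_top hp]
  rw [upperBoundary, if_pos (by omega)] at hl
  set K : ℝ≥0∞ := 1 + k * ENNReal.ofReal c + ENNReal.ofReal c with hK
  have hKt : K ≠ ∞ := by simp [hK, ENNReal.mul_eq_top]
  have hev : ∀ r ∈ Ioi l, min (post0 p r) (post1 p r)
      ≤ R.minContRisk (ENNReal.ofReal c) k (post0 p l) (post1 p l)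
        + K * (post1 p r - post1 p l) := by
    intro r (hr : l < r)
    have h1 : r ∉ contSet R c p T n := fun h =>
      (((le_sSup h).trans (le_max_right _ _)).trans hl).not_gt hr
    rw [mem_contSet_iff R hc p hkn, not_le] at h1
    refine h1.le.trans ((R.minContRisk_mono _ k (post0_antitone hr.le) le_rfl).trans ?_)
    have h2 := R.minContRisk_add_le (ENNReal.ofReal c) k (post0 p l) (post1 p l) 0
      (post1 p r - post1 p l)
    rwa [add_zero, zero_add, add_tsub_cancel_of_le (post1_monotone hr.le)] at h2
  have : (nhdsWithin l (Ioi l)).NeBot := nhdsGT_neBot_of_exists_gt ⟨⊤, hlt⟩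
  have hL : Continuous fun r => min (post0 p r) (post1 p r) :=
    continuous_post0.min continuous_post1
  have hR : Continuous fun r => R.minContRisk (ENNReal.ofReal c) k (post0 p l) (post1 p l)
      + K * (post1 p r - post1 p l) :=
    continuous_const.add ((ENNReal.continuous_const_mul hKt).comp
      ((ENNReal.continuous_sub_right _).comp continuous_post1))
  have h := le_of_tendsto_of_tendsto (hL.continuousWithinAt (s := Ioi l) (x := l))
    (hR.continuousWithinAt (s := Ioi l) (x := l)) (eventually_mem_nhdsWithin.mono hev)
  simpa using h

theorem min_post_le_of_le_lowerBoundary (hc : 0 ≤ c) (hp : p ∈ Ioo (0 : ℝ) 1)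
    (hkn : n + (k + 1) = T) {l : EReal} (hl : l ≤ lowerBoundary R c p T n) :
    min (post0 p l) (post1 p l)
      ≤ R.minContRisk (ENNReal.ofReal c) k (post0 p l) (post1 p l) := by
  rcases eq_or_lt_of_le (bot_le : ⊥ ≤ l) with rfl | hlt
  · simp [post1_bot hp]
  rw [lowerBoundary, if_pos (by omega)] at hl
  set K : ℝ≥0∞ := 1 + k * ENNReal.ofReal c + ENNReal.ofReal c with hK
  have hKt : K ≠ ∞ := by simp [hK, ENNReal.mul_eq_top]
  have hev : ∀ r ∈ Iio l, min (post0 p r) (post1 p r)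
      ≤ R.minContRisk (ENNReal.ofReal c) k (post0 p l) (post1 p l)
        + K * (post0 p r - post0 p l) := by
    intro r (hr : r < l)
    have h1 : r ∉ contSet R c p T n := fun h =>
      (hl.trans ((min_le_right _ _).trans (sInf_le h))).not_gt hr
    rw [mem_contSet_iff R hc p hkn, not_le] at h1
    refine h1.le.trans ((R.minContRisk_mono _ k le_rfl (post1_monotone hr.le)).trans ?_)
    have h2 := R.minContRisk_add_le (ENNReal.ofReal c) k (post0 p l) (post1 p l)
      (post0 p r - post0 p l) 0
    rwa [add_zero, add_zero, add_tsub_cancel_of_le (post0_antitone hr.le)] at h2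
  have : (nhdsWithin l (Iio l)).NeBot := nhdsLT_neBot_of_exists_lt ⟨⊥, hlt⟩
  have hL : Continuous fun r => min (post0 p r) (post1 p r) :=
    continuous_post0.min continuous_post1
  have hR : Continuous fun r => R.minContRisk (ENNReal.ofReal c) k (post0 p l) (post1 p l)
      + K * (post0 p r - post0 p l) :=
    continuous_const.add ((ENNReal.continuous_const_mul hKt).comp
      ((ENNReal.continuous_sub_right _).comp continuous_post0))
  have h := le_of_tendsto_of_tendsto (hL.continuousWithinAt (s := Iio l) (x := l))
    (hR.continuousWithinAt (s := Iio l) (x := l)) (eventually_mem_nhdsWithin.mono hev)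
  simpa using h

/-- A point strictly inside the boundaries lies between the log prior odds and some element of the
continuation set, on whichever side it is. -/
theorem mem_contSet_of_between (hc : 0 ≤ c) (hp : p ∈ Ioo (0 : ℝ) 1) (hkn : n + (k + 1) = T)
    {l : EReal} (hA : l < upperBoundary R c p T n) (hB : lowerBoundary R c p T n < l) :
    l ∈ contSet R c p T n := by
  rw [upperBoundary, if_pos (by omega)] at hA
  rw [lowerBoundary, if_pos (by omega)] at hB
  rcases le_total (logPriorOdds p) l with h | h
  · obtain ⟨l', hl', hll'⟩ := lt_sSup_iff.1 ((lt_max_iff.1 hA).resolve_left h.not_gt)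
    exact R.contSet_of_le_of_logPriorOdds_le hc hp hkn hl' h hll'.le
  · obtain ⟨l', hl', hll'⟩ := sInf_lt_iff.1 ((min_lt_iff.1 hB).resolve_left h.not_gt)
    exact R.contSet_of_le_of_le_logPriorOdds hc hp hkn hl' h hll'.le

end Boundary

end ResponseModel

theorem upperBoundary_last {M : ℕ} {𝓧 : Type*} [MeasurableSpace 𝓧] (R : ResponseModel M 𝓧)
    (c p : ℝ) (T : ℕ) : upperBoundary R c p T T = logPriorOdds p := if_neg (lt_irrefl T)

theorem lowerBoundary_last {M : ℕ} {𝓧 : Type*} [MeasurableSpace 𝓧] (R : ResponseModel M 𝓧)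
    (c p : ℝ) (T : ℕ) : lowerBoundary R c p T T = logPriorOdds p := if_neg (lt_irrefl T)

/-! ### The boundary test is Bayes for its own prior -/

section SprtPolicy

variable {M : ℕ} {𝓧 : Type*} [MeasurableSpace 𝓧] (R : ResponseModel M 𝓧)

/-- The test that the dynamic programming algorithm returns for the prior `p`. -/
noncomputable def sprtPolicy (c : ℝ) (T : ℕ) (j : ℝ → ℕ → EReal → Fin M)
    (hj : IsSelectionRule R c T j) (p : ℝ) : MarkovPolicy M T where
  sel := j p
  measurable_sel n h := (hj.measurable n h).comp (measurable_const.prodMk measurable_id)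
  halt n := {l | upperBoundary R c p T n ≤ l ∨ l ≤ lowerBoundary R c p T n}
  measurableSet_halt _ _ := measurableSet_Ici.union measurableSet_Iic
  halt_last := by
    ext l
    simp [upperBoundary_last, lowerBoundary_last, le_total]
  up n := {l | upperBoundary R c p T n ≤ l}
  measurableSet_up _ _ := measurableSet_Ici

variable {c : ℝ} {T : ℕ} {j : ℝ → ℕ → EReal → Fin M} (hj : IsSelectionRule R c T j) {p : ℝ}

theorem sprtPolicy_isOptimal [Nonempty (Fin M)] (hc : 0 ≤ c) (hp : p ∈ Ioo (0 : ℝ) 1) :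
    (sprtPolicy R c T j hj p).IsOptimal R (ENNReal.ofReal c) p := by
  classical
  refine ⟨fun n k hnk l hl => ?_, fun n k hnk l hl => ?_⟩
  -- The upper boundary lies at or above the log prior odds and the lower one at or below, so the
  -- decision at stopping picks the label with the larger posterior.
  · have h1 : (if l ∈ (sprtPolicy R c T j hj p).up n then post0 p l else post1 p l)
        = min (post0 p l) (post1 p l) := by
      by_cases hu : upperBoundary R c p T n ≤ l
      · have : logPriorOdds p ≤ l := by
          refine le_trans ?_ hu
          unfold upperBoundary
          split_ifs
          exacts [le_max_left _ _, le_rfl]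
        have hu' : l ∈ (sprtPolicy R c T j hj p).up n := hu
        rw [if_pos hu', min_eq_left ((post_compare hp l).1.1 this)]
      · have hlow : l ≤ lowerBoundary R c p T n := Or.resolve_left hl hu
        have : l ≤ logPriorOdds p := by
          refine le_trans hlow ?_
          unfold lowerBoundary
          split_ifs
          exacts [min_le_left _ _, le_rfl]
        have hu' : l ∉ (sprtPolicy R c T j hj p).up n := hu
        rw [if_neg hu', min_eq_right ((post_compare hp l).2.1 this)]
    cases k with
    | zero => exact h1.le
    | succ k =>
      refine le_trans h1.le (le_min ?_ le_rfl)
      rcases hl with hl | hl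
      exacts [R.min_post_le_of_upperBoundary_le hc hp hnk hl,
        R.min_post_le_of_le_lowerBoundary hc hp hnk hl]
  · have hl' : l ∈ contSet R c p T n :=
      R.mem_contSet_of_between hc hp hnk (not_le.1 fun h => hl (Or.inl h))
        (not_le.1 fun h => hl (Or.inr h))
    rw [R.mem_contSet_iff hc p hnk] at hl'
    have hle : R.contRisk (ENNReal.ofReal c) k (post0 p l) (post1 p l) (j p n l)
        ≤ ⨅ δ, R.contRisk (ENNReal.ofReal c) k (post0 p l) (post1 p l) δ := by
      refine le_iInf fun δ => ?_
      have h := hj.isArgmin p ⟨hp.1.le, hp.2.le⟩ n (by omega) l δ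
      rw [R.nextRisk_eq hc p hnk, R.nextRisk_eq hc p hnk, add_le_add_iff_right] at h
      have ht (δ) := R.contRisk_ne_top (c := ENNReal.ofReal c) ENNReal.ofReal_ne_top k
        (post0_ne_top p l) (post1_ne_top p l) δ
      exact (ENNReal.toReal_le_toReal (ht _) (ht _)).1 h
    exact le_min hle (hle.trans hl')

/-- The test that the dynamic programming algorithm returns, as an adaptive design. -/
noncomputable def sprtDesign (p : ℝ) : AdaptiveDesign M T 𝓧 :=
  (sprtPolicy R c T j hj p).design R 0

theorem sprtDesign_N (x : Fin T → 𝓧) : (sprtDesign R hj p).N x = sprtN R c j p x := by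
  change MarkovPolicy.time R _ 0 x = _
  simp only [MarkovPolicy.time, sprtN, sprtLLR_eq_policyLLR]
  rfl

theorem sprtDesign_D (x : Fin T → 𝓧) : (sprtDesign R hj p).D x = sprtD R c j p x := by
  have h : MarkovPolicy.time R (sprtPolicy R c T j hj p) 0 x = sprtN R c j p x :=
    sprtDesign_N R hj x
  change MarkovPolicy.decision R _ 0 x = _
  rw [MarkovPolicy.decision, sprtD, h]
  simp only [sprtLLR_eq_policyLLR]
  by_cases hu : upperBoundary R c p T (sprtN R c j p x)
      ≤ policyLLR R (j p) 0 x (sprtN R c j p x)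
  · exact (if_pos hu).trans (if_pos hu).symm
  · exact (if_neg hu).trans (if_neg hu).symm

theorem sprtDesign_law (θ : Fin 2) : (sprtDesign R hj p).law R θ = R.seqLaw θ (sprtSel R j p) := by
  unfold AdaptiveDesign.law
  congr 1
  funext n x
  change j p n (policyLLR R (j p) 0 (firstResponses n.isLt.le x) n) = _
  rw [policyLLR_firstResponses R _ _ _ _ le_rfl, sprtSel, sprtLLR_eq_policyLLR]

theorem weightedRisk_sprtDesign [Nonempty (Fin M)] (hc : 0 ≤ c) (hp : p ∈ Ioo (0 : ℝ) 1) :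
    (sprtDesign R hj p).weightedRisk R (ENNReal.ofReal c) (ENNReal.ofReal (1 - p))
        (ENNReal.ofReal p)
      = R.optRisk (ENNReal.ofReal c) T (ENNReal.ofReal (1 - p)) (ENNReal.ofReal p) := by
  refine le_antisymm ?_ (AdaptiveDesign.optRisk_le_weightedRisk R _ _ _ _)
  have h := (sprtPolicy R c T j hj p).weightedRisk_design_le R
    (sprtPolicy_isOptimal R hj hc hp) 0 ENNReal.one_ne_top
  rwa [one_mul, one_mul, post0_zero p ⟨hp.1.le, hp.2.le⟩, post1_zero p ⟨hp.1.le, hp.2.le⟩] at h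

end SprtPolicy

/-! ### Bayes risk as an affine function of the prior -/

namespace AdaptiveDesign

variable {M T : ℕ} {𝓧 : Type*} [MeasurableSpace 𝓧] (R : ResponseModel M 𝓧)

theorem loss_le (d : AdaptiveDesign M T 𝓧) (c : ℝ≥0∞) (θ : Fin 2) (x : Fin T → 𝓧) :
    d.loss c θ x ≤ 1 + c * T := by
  unfold loss
  gcongr
  · split_ifs <;> simp
  · exact d.N_le x

theorem lintegral_loss_le (d : AdaptiveDesign M T 𝓧) (c : ℝ≥0∞) (θ : Fin 2) :
    ∫⁻ x, d.loss c θ x ∂(d.law R θ) ≤ 1 + c * T := by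
  have := d.isProbabilityMeasure_law R θ
  exact (lintegral_mono (d.loss_le c θ)).trans (by simp)

theorem lintegral_loss_ne_top (d : AdaptiveDesign M T 𝓧) {c : ℝ≥0∞} (hc : c ≠ ∞) (θ : Fin 2) :
    ∫⁻ x, d.loss c θ x ∂(d.law R θ) ≠ ∞ := by
  refine ne_top_of_le_ne_top ?_ (d.lintegral_loss_le R c θ)
  simp [ENNReal.mul_eq_top, hc]

/-- The expected loss when the true label is `θ`. -/
noncomputable def labelRisk (d : AdaptiveDesign M T 𝓧) (c : ℝ) (θ : Fin 2) : ℝ :=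
  (∫⁻ x, d.loss (ENNReal.ofReal c) θ x ∂(d.law R θ)).toReal

theorem labelRisk_nonneg (d : AdaptiveDesign M T 𝓧) (c : ℝ) (θ : Fin 2) :
    0 ≤ d.labelRisk R c θ := ENNReal.toReal_nonneg

theorem labelRisk_le (d : AdaptiveDesign M T 𝓧) {c : ℝ} (hc : 0 ≤ c) (θ : Fin 2) :
    d.labelRisk R c θ ≤ 1 + c * T := by
  refine ENNReal.toReal_le_of_le_ofReal (by positivity) ?_
  refine (d.lintegral_loss_le R _ θ).trans_eq ?_
  rw [ENNReal.ofReal_add zero_le_one (by positivity), ENNReal.ofReal_mul hc]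
  simp

theorem labelRisk_eq (d : AdaptiveDesign M T 𝓧) {c : ℝ} (hc : 0 ≤ c) (θ : Fin 2) :
    d.labelRisk R c θ = (d.law R θ).real {x | d.D x ≠ θ} + c * ∫ x, (d.N x : ℝ) ∂(d.law R θ) := by
  have hpr := d.isProbabilityMeasure_law R θ
  have hD : MeasurableSet {x | d.D x ≠ θ} := d.measurable_D (measurableSet_singleton θ).compl
  have hN : Measurable fun x => (d.N x : ℝ≥0∞) :=
    (measurable_from_top (f := fun n : ℕ => (n : ℝ≥0∞))).comp d.measurable_N
  have hsplit : ∫⁻ x, d.loss (ENNReal.ofReal c) θ x ∂(d.law R θ)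
      = d.law R θ {x | d.D x ≠ θ} + ENNReal.ofReal c * ∫⁻ x, (d.N x : ℝ≥0∞) ∂(d.law R θ) := by
    unfold loss
    rw [lintegral_add_right _ (hN.const_mul _), lintegral_const_mul _ hN,
      ← lintegral_indicator_one hD]
    congr 2
    funext x
    simp [indicator_apply]
  have hNt : ∫⁻ x, (d.N x : ℝ≥0∞) ∂(d.law R θ) ≠ ∞ := by
    refine ne_top_of_le_ne_top (b := (T : ℝ≥0∞)) (by simp) ?_
    refine (lintegral_mono (g := fun _ => (T : ℝ≥0∞)) fun x => ?_).trans (by simp)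
    exact Nat.cast_le.2 (d.N_le x)
  rw [labelRisk, hsplit, ENNReal.toReal_add (measure_ne_top _ _)
    (ENNReal.mul_ne_top ENNReal.ofReal_ne_top hNt), ENNReal.toReal_mul, ENNReal.toReal_ofReal hc,
    ← integral_toReal hN.aemeasurable (Eventually.of_forall fun x => by simp)]
  simp [Measure.real]

theorem bayesRisk_eq_labelRisk (d : AdaptiveDesign M T 𝓧) {c : ℝ} (hc : 0 ≤ c) (p : ℝ) :
    bayesRisk R c p d = (1 - p) * d.labelRisk R c 0 + p * d.labelRisk R c 1 := by
  have h0 : {x | d.D x = 1} = {x | d.D x ≠ 0} := by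
    ext x
    simp only [mem_ofPred_eq]
    omega
  have h1 : {x | d.D x = 0} = {x | d.D x ≠ 1} := by
    ext x
    simp only [mem_ofPred_eq]
    omega
  rw [labelRisk_eq R d hc, labelRisk_eq R d hc, bayesRisk, h0, h1]
  ring

theorem toReal_weightedRisk (d : AdaptiveDesign M T 𝓧) {c : ℝ} (hc : 0 ≤ c) {p : ℝ}
    (hp : p ∈ Icc (0 : ℝ) 1) :
    (d.weightedRisk R (ENNReal.ofReal c) (ENNReal.ofReal (1 - p)) (ENNReal.ofReal p)).toReal
      = bayesRisk R c p d := by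
  have h (θ) := d.lintegral_loss_ne_top R (c := ENNReal.ofReal c) ENNReal.ofReal_ne_top θ
  rw [bayesRisk_eq_labelRisk R d hc, weightedRisk,
    ENNReal.toReal_add (ENNReal.mul_ne_top ENNReal.ofReal_ne_top (h 0))
      (ENNReal.mul_ne_top ENNReal.ofReal_ne_top (h 1)), ENNReal.toReal_mul, ENNReal.toReal_mul,
    ENNReal.toReal_ofReal (by linarith [hp.2]), ENNReal.toReal_ofReal hp.1]
  rfl

theorem weightedRisk_ne_top (d : AdaptiveDesign M T 𝓧) {c a b : ℝ≥0∞} (hc : c ≠ ∞) (ha : a ≠ ∞)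
    (hb : b ≠ ∞) : d.weightedRisk R c a b ≠ ∞ :=
  ENNReal.add_ne_top.2 ⟨ENNReal.mul_ne_top ha (d.lintegral_loss_ne_top R hc 0),
    ENNReal.mul_ne_top hb (d.lintegral_loss_ne_top R hc 1)⟩

/-- For a fixed design the risk is affine in the prior. Its slope is the difference of the two label
risks, which lie in `[0, 1 + c * T]`. -/
theorem bayesRisk_sub_le (d : AdaptiveDesign M T 𝓧) {c : ℝ} (hc : 0 ≤ c) (p q : ℝ) :
    bayesRisk R c p d ≤ bayesRisk R c q d + (1 + c * T) * |p - q| := by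
  rw [bayesRisk_eq_labelRisk R d hc, bayesRisk_eq_labelRisk R d hc]
  have h : |(p - q) * (d.labelRisk R c 1 - d.labelRisk R c 0)| ≤ (1 + c * T) * |p - q| := by
    rw [abs_mul, mul_comm]
    gcongr
    rw [abs_le]
    constructor <;> linarith [d.labelRisk_nonneg R c 0, d.labelRisk_nonneg R c 1,
      d.labelRisk_le R hc 0, d.labelRisk_le R hc 1]
  linarith [le_abs_self ((p - q) * (d.labelRisk R c 1 - d.labelRisk R c 0))]

theorem bayesRisk_le (d : AdaptiveDesign M T 𝓧) {c : ℝ} (hc : 0 ≤ c) {p : ℝ}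
    (hp : p ∈ Icc (0 : ℝ) 1) : bayesRisk R c p d ≤ 1 + c * T := by
  rw [bayesRisk_eq_labelRisk R d hc]
  nlinarith [mul_le_mul_of_nonneg_left (d.labelRisk_le R hc 0) (sub_nonneg.2 hp.2),
    mul_le_mul_of_nonneg_left (d.labelRisk_le R hc 1) hp.1]

theorem bayesRisk_nonneg (d : AdaptiveDesign M T 𝓧) {c : ℝ} (hc : 0 ≤ c) {p : ℝ}
    (hp : p ∈ Icc (0 : ℝ) 1) : 0 ≤ bayesRisk R c p d := by
  rw [bayesRisk_eq_labelRisk R d hc]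
  exact add_nonneg (mul_nonneg (sub_nonneg.2 hp.2) (d.labelRisk_nonneg R c 0))
    (mul_nonneg hp.1 (d.labelRisk_nonneg R c 1))

end AdaptiveDesign

section SprtRisk

variable {M T : ℕ} {𝓧 : Type*} [MeasurableSpace 𝓧] (R : ResponseModel M 𝓧) {c : ℝ}
  {j : ℝ → ℕ → EReal → Fin M} (hj : IsSelectionRule R c T j) {p q : ℝ}

theorem bayesRisk_sprtDesign_le [Nonempty (Fin M)] (hc : 0 ≤ c) (hp : p ∈ Ioo (0 : ℝ) 1)
    (d : AdaptiveDesign M T 𝓧) : bayesRisk R c p (sprtDesign R hj p) ≤ bayesRisk R c p d := by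
  have hp' : p ∈ Icc (0 : ℝ) 1 := ⟨hp.1.le, hp.2.le⟩
  rw [← AdaptiveDesign.toReal_weightedRisk R _ hc hp',
    ← AdaptiveDesign.toReal_weightedRisk R d hc hp', weightedRisk_sprtDesign R hj hc hp]
  exact ENNReal.toReal_mono (d.weightedRisk_ne_top R ENNReal.ofReal_ne_top ENNReal.ofReal_ne_top
    ENNReal.ofReal_ne_top) (d.optRisk_le_weightedRisk R _ _ _)

/-- For `p` inside the unit interval, pass from prior `q` to `p`, use optimality of the test for
`p`, and pass back. At `p = 0` and `p = 1`, where that optimality is not at hand, the trivial bound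
`C` on the risk suffices because `|p - q|` is bounded below. -/
theorem exists_abs_bayesRisk_sprtDesign_sub_le [Nonempty (Fin M)] (hc : 0 ≤ c)
    (hq : q ∈ Ioo (0 : ℝ) 1) : ∃ L : ℝ, 0 ≤ L ∧ ∀ p ∈ Icc (0 : ℝ) 1,
      |bayesRisk R c q (sprtDesign R hj p) - bayesRisk R c q (sprtDesign R hj q)|
        ≤ L * |p - q| := by
  set C : ℝ := 1 + c * T with hC
  have hC0 : 0 ≤ C := by positivity
  have hq' : q ∈ Icc (0 : ℝ) 1 := ⟨hq.1.le, hq.2.le⟩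
  have hq0 := hq.1
  have hq1 : 0 < 1 - q := sub_pos.2 hq.2
  -- `2 * C` pays for the two changes of prior; `C / q` and `C / (1 - q)` serve `p = 0` and `p = 1`,
  -- where `|p - q|` equals `q` and `1 - q`.
  refine ⟨2 * C + C / q + C / (1 - q), by positivity, fun p hp => ?_⟩
  rw [abs_of_nonneg (sub_nonneg.2 (bayesRisk_sprtDesign_le R hj hc hq _))]
  have hn : 0 ≤ |p - q| := abs_nonneg _
  have hCq : 0 ≤ C / q * |p - q| := by positivity
  have hCq' : 0 ≤ C / (1 - q) * |p - q| := by positivity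
  have hCn : 0 ≤ C * |p - q| := by positivity
  have h0 := (sprtDesign R hj q).bayesRisk_nonneg R hc hq'
  have h1 := (sprtDesign R hj p).bayesRisk_le R hc hq'
  rcases eq_or_lt_of_le hp.1 with rfl | hp0
  · have : C / q * |0 - q| = C := by
      rw [zero_sub, abs_neg, abs_of_pos hq0, div_mul_cancel₀ _ hq0.ne']
    linarith
  rcases eq_or_lt_of_le hp.2 with rfl | hp1
  · have : C / (1 - q) * |1 - q| = C := by
      rw [abs_of_pos hq1, div_mul_cancel₀ _ hq1.ne']
    linarith
  have h2 := (sprtDesign R hj p).bayesRisk_sub_le R hc q p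
  have h3 := bayesRisk_sprtDesign_le R hj hc ⟨hp0, hp1⟩ (sprtDesign R hj q)
  have h4 := (sprtDesign R hj q).bayesRisk_sub_le R hc p q
  rw [abs_sub_comm] at h2
  linarith

/-- The loss of the test with the prior `p` for one object. -/
noncomputable def objectLoss (c : ℝ) (j : ℝ → ℕ → EReal → Fin M) (p : ℝ)
    (z : Fin 2 × (Fin T → 𝓧)) : ℝ :=
  (if sprtD R c j p z.2 ≠ z.1 then 1 else 0) + c * (sprtN R c j p z.2 : ℝ)

theorem lintegral_objectLaw {j : ℝ → ℕ → EReal → Fin M} {π₁ p : ℝ}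
    {G : Fin 2 × (Fin T → 𝓧) → ℝ≥0∞} (hG : Measurable G)
    [SFinite (R.seqLaw (T := T) 0 (sprtSel R j p))]
    [SFinite (R.seqLaw (T := T) 1 (sprtSel R j p))] :
    ∫⁻ z, G z ∂(objectLaw R j T π₁ p)
      = ENNReal.ofReal (1 - π₁) * ∫⁻ x, G (0, x) ∂(R.seqLaw 0 (sprtSel R j p))
        + ENNReal.ofReal π₁ * ∫⁻ x, G (1, x) ∂(R.seqLaw 1 (sprtSel R j p)) := by
  rw [objectLaw, lintegral_add_measure, lintegral_smul_measure, lintegral_smul_measure,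
    Measure.dirac_prod, Measure.dirac_prod, lintegral_map hG measurable_prodMk_left,
    lintegral_map hG measurable_prodMk_left]
  rfl

theorem isProbabilityMeasure_seqLaw_sprtSel (hj : IsSelectionRule R c T j) (θ : Fin 2) (p : ℝ) :
    IsProbabilityMeasure (R.seqLaw (T := T) θ (sprtSel R j p)) := by
  rw [← sprtDesign_law R hj]
  exact AdaptiveDesign.isProbabilityMeasure_law R _ _

end SprtRisk

/-! ### Joint measurability in the prior and the responses -/

section JointMeasurability

variable {M T : ℕ} {𝓧 : Type*} [MeasurableSpace 𝓧] (R : ResponseModel M 𝓧) {c : ℝ}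
  {j : ℝ → ℕ → EReal → Fin M}

theorem measurable_logPriorOdds : Measurable logPriorOdds := by
  unfold logPriorOdds
  exact Measurable.ennreal_log (by fun_prop)

theorem ResponseModel.measurableSet_mem_contSet [Nonempty (Fin M)] (hc : 0 ≤ c) {n k : ℕ}
    (hkn : n + (k + 1) = T) (r : EReal) : MeasurableSet {p | r ∈ contSet R c p T n} := by
  have h0 : Measurable fun p : ℝ => post0 p r :=
    measurable_post0.comp (measurable_prodMk_right (y := r))
  have h1 : Measurable fun p : ℝ => post1 p r :=
    measurable_post1.comp (measurable_prodMk_right (y := r))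
  have h2 : Measurable fun p : ℝ =>
      R.minContRisk (ENNReal.ofReal c) k (post0 p r) (post1 p r) :=
    Measurable.comp (g := fun q : ℝ≥0∞ × ℝ≥0∞ => R.minContRisk (ENNReal.ofReal c) k q.1 q.2)
      (f := fun p => (post0 p r, post1 p r)) (R.measurable_minContRisk (ENNReal.ofReal c) k)
      (h0.prodMk h1)
  have h3 : {p | r ∈ contSet R c p T n}
      = {p | R.minContRisk (ENNReal.ofReal c) k (post0 p r) (post1 p r)
        ≤ min (post0 p r) (post1 p r)} := by
    ext p
    rw [mem_ofPred_eq, mem_ofPred_eq, R.mem_contSet_iff hc p hkn r, minContRisk]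
  rw [h3]
  exact measurableSet_le h2 (h0.min h1)

/-- For such a prior the posterior does not depend on the ratio, so the continuation set is empty or
everything. This extends the interval property to all real priors, which measurability in `p`
requires. -/
theorem ResponseModel.mem_contSet_congr_of_notMem_Ioo [Nonempty (Fin M)] (hc : 0 ≤ c) {n k : ℕ}
    (hkn : n + (k + 1) = T) {p : ℝ} (hp : p ∉ Ioo (0 : ℝ) 1) {l r : EReal}
    (hl : l ∈ contSet R c p T n) : r ∈ contSet R c p T n := by
  have h : post0 p r = post0 p l := by
    rcases le_or_gt p 0 with h0 | h0
    · rw [post0_of_nonpos h0, post0_of_nonpos h0]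
    · have h1 : 1 ≤ p := not_lt.1 fun h => hp ⟨h0, h⟩
      rw [post0_of_one_le h1, post0_of_one_le h1]
  rw [R.mem_contSet_iff hc p hkn] at hl ⊢
  rwa [post1, h]

theorem ResponseModel.contSet_of_le_of_logPriorOdds_le' [Nonempty (Fin M)] (hc : 0 ≤ c) {n k : ℕ}
    (hkn : n + (k + 1) = T) {p : ℝ} {l r : EReal} (hl : l ∈ contSet R c p T n)
    (hr : logPriorOdds p ≤ r) (hrl : r ≤ l) : r ∈ contSet R c p T n := by
  by_cases hp : p ∈ Ioo (0 : ℝ) 1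
  · exact R.contSet_of_le_of_logPriorOdds_le hc hp hkn hl hr hrl
  · exact R.mem_contSet_congr_of_notMem_Ioo hc hkn hp hl

theorem ResponseModel.contSet_of_le_of_le_logPriorOdds' [Nonempty (Fin M)] (hc : 0 ≤ c) {n k : ℕ}
    (hkn : n + (k + 1) = T) {p : ℝ} {l r : EReal} (hl : l ∈ contSet R c p T n)
    (hr : r ≤ logPriorOdds p) (hlr : l ≤ r) : r ∈ contSet R c p T n := by
  by_cases hp : p ∈ Ioo (0 : ℝ) 1
  · exact R.contSet_of_le_of_le_logPriorOdds hc hp hkn hl hr hlr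
  · exact R.mem_contSet_congr_of_notMem_Ioo hc hkn hp hl

/-- The supremum runs over an uncountable set that varies with `p`. Because of the interval
property, it exceeds `a ≥ logPriorOdds p` exactly when some point above `a` of a fixed countable
dense set is in the continuation set. -/
theorem measurable_upperBoundary [Nonempty (Fin M)] (hc : 0 ≤ c) (n : ℕ) :
    Measurable fun p => upperBoundary R c p T n := by
  by_cases hn : n < T
  swap
  · simpa only [upperBoundary, if_neg hn] using measurable_logPriorOdds
  simp only [upperBoundary, if_pos hn]
  obtain ⟨k, hkn⟩ : ∃ k, n + (k + 1) = T := ⟨T - n - 1, by omega⟩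
  obtain ⟨S, hSc, hSd⟩ := TopologicalSpace.exists_countable_dense EReal
  refine measurable_of_Iic fun a => ?_
  have : (fun p => max (logPriorOdds p) (sSup (contSet R c p T n))) ⁻¹' Iic a
      = {p | logPriorOdds p ≤ a} ∩ ⋂ r ∈ S ∩ Ioi a, {p | r ∈ contSet R c p T n}ᶜ := by
    ext p
    simp only [mem_preimage, mem_Iic, max_le_iff, mem_inter_iff, mem_iInter, mem_compl_iff,
      mem_ofPred_eq, mem_Ioi]
    refine and_congr_right fun hp => ⟨fun h r hr hrC => ?_, fun h => sSup_le fun l hl => ?_⟩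
    · exact ((le_sSup hrC).trans h).not_gt hr.2
    · by_contra! hal
      obtain ⟨r, hrS, har, hrl⟩ := hSd.exists_between hal
      exact h r ⟨hrS, har⟩
        (R.contSet_of_le_of_logPriorOdds_le' hc hkn hl (hp.trans har.le) hrl.le)
  rw [this]
  exact (measurableSet_le measurable_logPriorOdds measurable_const).inter
    (MeasurableSet.biInter (hSc.mono inter_subset_left)
      fun r _ => (R.measurableSet_mem_contSet hc hkn r).compl)

theorem measurable_lowerBoundary [Nonempty (Fin M)] (hc : 0 ≤ c) (n : ℕ) :
    Measurable fun p => lowerBoundary R c p T n := by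
  by_cases hn : n < T
  swap
  · simpa only [lowerBoundary, if_neg hn] using measurable_logPriorOdds
  simp only [lowerBoundary, if_pos hn]
  obtain ⟨k, hkn⟩ : ∃ k, n + (k + 1) = T := ⟨T - n - 1, by omega⟩
  obtain ⟨S, hSc, hSd⟩ := TopologicalSpace.exists_countable_dense EReal
  refine measurable_of_Ici fun a => ?_
  have : (fun p => min (logPriorOdds p) (sInf (contSet R c p T n))) ⁻¹' Ici a
      = {p | a ≤ logPriorOdds p} ∩ ⋂ r ∈ S ∩ Iio a, {p | r ∈ contSet R c p T n}ᶜ := by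
    ext p
    simp only [mem_preimage, mem_Ici, le_min_iff, mem_inter_iff, mem_iInter, mem_compl_iff,
      mem_ofPred_eq, mem_Iio]
    refine and_congr_right fun hp => ⟨fun h r hr hrC => ?_, fun h => le_sInf fun l hl => ?_⟩
    · exact (h.trans (sInf_le hrC)).not_gt hr.2
    · by_contra! hal
      obtain ⟨r, hrS, hlr, hra⟩ := hSd.exists_between hal
      exact h r ⟨hrS, hra⟩
        (R.contSet_of_le_of_le_logPriorOdds' hc hkn hl (hra.le.trans hp) hlr.le)
  rw [this]
  exact (measurableSet_le measurable_const measurable_logPriorOdds).inter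
    (MeasurableSet.biInter (hSc.mono inter_subset_left)
      fun r _ => (R.measurableSet_mem_contSet hc hkn r).compl)

theorem measurable_sprtLLR (hj : IsSelectionRule R c T j) (n : ℕ) :
    Measurable fun q : ℝ × (Fin T → 𝓧) => sprtLLR R j q.1 q.2 n := by
  simp only [sprtLLR_eq_policyLLR]
  exact measurable_policyLLR R (sel := fun q : ℝ × (Fin T → 𝓧) => j q.1)
    (fun m hm => (hj.measurable m hm).comp
      ((measurable_fst.comp measurable_fst).prodMk measurable_snd)) measurable_snd 0 n

theorem measurable_sprtSel (hj : IsSelectionRule R c T j) (n : Fin T) :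
    Measurable fun q : ℝ × (Fin T → 𝓧) => sprtSel R j q.1 n q.2 :=
  (hj.measurable n n.isLt).comp (measurable_fst.prodMk (measurable_sprtLLR R hj n))

theorem measurable_sprtN [Nonempty (Fin M)] (hc : 0 ≤ c) (hj : IsSelectionRule R c T j) :
    Measurable fun q : ℝ × (Fin T → 𝓧) => sprtN R c j q.1 q.2 := by
  have hne (q : ℝ × (Fin T → 𝓧)) : {n | upperBoundary R c q.1 T n ≤ sprtLLR R j q.1 q.2 n ∨
      sprtLLR R j q.1 q.2 n ≤ lowerBoundary R c q.1 T n}.Nonempty :=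
    ⟨T, by simp [upperBoundary_last, lowerBoundary_last, le_total]⟩
  have hst (n : ℕ) : MeasurableSet {q : ℝ × (Fin T → 𝓧) |
      upperBoundary R c q.1 T n ≤ sprtLLR R j q.1 q.2 n ∨
        sprtLLR R j q.1 q.2 n ≤ lowerBoundary R c q.1 T n} :=
    (measurableSet_le ((measurable_upperBoundary R hc n).comp measurable_fst)
      (measurable_sprtLLR R hj n)).union (measurableSet_le (measurable_sprtLLR R hj n)
        ((measurable_lowerBoundary R hc n).comp measurable_fst))
  refine measurable_to_countable' fun n => ?_
  have : (fun q : ℝ × (Fin T → 𝓧) => sprtN R c j q.1 q.2) ⁻¹' {n}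
      = {q | upperBoundary R c q.1 T n ≤ sprtLLR R j q.1 q.2 n ∨
        sprtLLR R j q.1 q.2 n ≤ lowerBoundary R c q.1 T n} ∩
        ⋂ k, ⋂ (_ : k < n), {q | upperBoundary R c q.1 T k ≤ sprtLLR R j q.1 q.2 k ∨
          sprtLLR R j q.1 q.2 k ≤ lowerBoundary R c q.1 T k}ᶜ := by
    ext q
    rw [mem_preimage, mem_singleton_iff, sprtN, Nat.sInf_eq_iff_of_nonempty (hne q)]
    simp only [mem_inter_iff, mem_iInter, mem_compl_iff, mem_ofPred_eq]
  rw [this]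
  exact (hst n).inter (MeasurableSet.iInter fun k => MeasurableSet.iInter fun _ => (hst k).compl)

theorem measurable_sprtD [Nonempty (Fin M)] (hc : 0 ≤ c) (hj : IsSelectionRule R c T j) :
    Measurable fun q : ℝ × (Fin T → 𝓧) => sprtD R c j q.1 q.2 := by
  have hN := measurable_sprtN R hc hj
  have hU : Measurable fun q : ℝ × (Fin T → 𝓧) =>
      upperBoundary R c q.1 T (sprtN R c j q.1 q.2) :=
    (measurable_from_prod_countable_right (f := fun z : ℕ × ℝ => upperBoundary R c z.2 T z.1)
      fun n => measurable_upperBoundary R hc n).comp (hN.prodMk measurable_fst)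
  have hL : Measurable fun q : ℝ × (Fin T → 𝓧) =>
      sprtLLR R j q.1 q.2 (sprtN R c j q.1 q.2) :=
    (measurable_from_prod_countable_right
      (f := fun z : ℕ × (ℝ × (Fin T → 𝓧)) => sprtLLR R j z.2.1 z.2.2 z.1)
      fun n => measurable_sprtLLR R hj n).comp (hN.prodMk measurable_id)
  unfold sprtD
  exact Measurable.ite (measurableSet_le hU hL) measurable_const measurable_const

theorem measurable_objectLoss [Nonempty (Fin M)] (hc : 0 ≤ c) (hj : IsSelectionRule R c T j) :
    Measurable fun q : ℝ × (Fin 2 × (Fin T → 𝓧)) => objectLoss R c j q.1 q.2 := by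
  have hpx : Measurable fun q : ℝ × (Fin 2 × (Fin T → 𝓧)) => (q.1, q.2.2) :=
    measurable_fst.prodMk (measurable_snd.comp measurable_snd)
  have hD := (measurable_sprtD R hc hj).comp hpx
  have hN := (measurable_sprtN R hc hj).comp hpx
  have hθ : Measurable fun q : ℝ × (Fin 2 × (Fin T → 𝓧)) => q.2.1 :=
    measurable_fst.comp measurable_snd
  unfold objectLoss
  refine Measurable.add ?_ (measurable_const.mul ?_)
  · exact (measurable_from_top (f := fun a : Fin 2 × Fin 2 =>
      if a.1 ≠ a.2 then (1 : ℝ) else 0)).comp ((hD.prodMk hθ).mono le_rfl (by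
        intro s _; exact s.toFinite.measurableSet))
  · exact (measurable_from_top (f := fun n : ℕ => (n : ℝ))).comp hN

theorem sprtN_le (p : ℝ) (x : Fin T → 𝓧) : sprtN R c j p x ≤ T :=
  Nat.sInf_le (by simp [upperBoundary_last, lowerBoundary_last, le_total])

theorem objectLoss_mem_Icc (hc : 0 ≤ c) (p : ℝ) (z : Fin 2 × (Fin T → 𝓧)) :
    objectLoss R c j p z ∈ Icc (0 : ℝ) (1 + c * T) := by
  have h1 : (0 : ℝ) ≤ if sprtD R c j p z.2 ≠ z.1 then 1 else 0 := by split_ifs <;> norm_num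
  have h2 : (if sprtD R c j p z.2 ≠ z.1 then 1 else 0 : ℝ) ≤ 1 := by split_ifs <;> norm_num
  have h3 : (sprtN R c j p z.2 : ℝ) ≤ T := Nat.cast_le.2 (sprtN_le R p z.2)
  exact ⟨by unfold objectLoss; positivity, by unfold objectLoss; gcongr⟩

theorem measurable_objectLaw (hj : IsSelectionRule R c T j) (π₁ : ℝ) :
    Measurable fun p => objectLaw R j T π₁ p := by
  refine Measure.measurable_of_measurable_coe _ fun S hS => ?_
  have hpr (θ p) := isProbabilityMeasure_seqLaw_sprtSel R hj θ p
  have hind : Measurable (S.indicator (1 : Fin 2 × (Fin T → 𝓧) → ℝ≥0∞)) :=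
    measurable_one.indicator hS
  have hsel (p : ℝ) (n : Fin T) : Measurable (sprtSel R j p n) :=
    (measurable_sprtSel R hj n).comp (measurable_const.prodMk measurable_id)
  have hθ (θ : Fin 2) : Measurable fun p =>
      ∫⁻ x, S.indicator (1 : Fin 2 × (Fin T → 𝓧) → ℝ≥0∞) (θ, x) ∂(R.seqLaw θ (sprtSel R j p)) := by
    have h (p : ℝ) := R.lintegral_seqLaw θ (hsel p) (hind.comp (measurable_prodMk_left (x := θ)))
    have hm := Measurable.lintegral_prod_right' (ν := Measure.pi fun _ : Fin T => R.ν)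
      ((R.measurable_seqDensity θ (fun n => measurable_sprtSel R hj n) measurable_snd).mul
        (hind.comp ((measurable_const (a := θ)).prodMk measurable_snd)))
    exact (funext h : _ = _) ▸ hm
  have heq (p : ℝ) : objectLaw R j T π₁ p S
      = ENNReal.ofReal (1 - π₁) * ∫⁻ x, S.indicator 1 (0, x) ∂(R.seqLaw 0 (sprtSel R j p))
        + ENNReal.ofReal π₁ * ∫⁻ x, S.indicator 1 (1, x) ∂(R.seqLaw 1 (sprtSel R j p)) := by
    rw [← lintegral_objectLaw R hind, lintegral_indicator_one hS]
  simp only [heq]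
  exact ((hθ 0).const_mul _).add ((hθ 1).const_mul _)

/-- The law of the label and the responses of one object as a kernel in the prior. -/
noncomputable def objectKernel (hj : IsSelectionRule R c T j) (π₁ : ℝ) :
    ProbabilityTheory.Kernel ℝ (Fin 2 × (Fin T → 𝓧)) where
  toFun p := objectLaw R j T π₁ p
  measurable' := measurable_objectLaw R hj π₁

theorem isMarkovKernel_objectKernel (hj : IsSelectionRule R c T j) {π₁ : ℝ}
    (hπ : π₁ ∈ Icc (0 : ℝ) 1) : ProbabilityTheory.IsMarkovKernel (objectKernel R hj π₁) := by
  refine ⟨fun p => ⟨?_⟩⟩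
  have hpr (θ) := isProbabilityMeasure_seqLaw_sprtSel R hj θ p
  rw [← lintegral_one]
  refine (lintegral_objectLaw R measurable_const).trans ?_
  simp only [lintegral_const, measure_univ, mul_one]
  rw [← ENNReal.ofReal_add (by linarith [hπ.2]) hπ.1]
  simp

/-- Two priors enter separately: `p` shapes the design, `π₁` generates the label. -/
theorem integral_objectLoss [Nonempty (Fin M)] (hc : 0 ≤ c) (hj : IsSelectionRule R c T j)
    {π₁ : ℝ} (hπ : π₁ ∈ Icc (0 : ℝ) 1) (p : ℝ) :
    ∫ z, objectLoss R c j p z ∂(objectKernel R hj π₁ p) = bayesRisk R c π₁ (sprtDesign R hj p) := by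
  have hm : Measurable fun z : Fin 2 × (Fin T → 𝓧) => objectLoss R c j p z :=
    Measurable.comp (g := fun q : ℝ × (Fin 2 × (Fin T → 𝓧)) => objectLoss R c j q.1 q.2)
      (f := fun z => (p, z)) (measurable_objectLoss R hc hj) measurable_prodMk_left
  have hpr (θ) := isProbabilityMeasure_seqLaw_sprtSel R hj θ p
  rw [integral_eq_lintegral_of_nonneg_ae
    (Eventually.of_forall fun z => (objectLoss_mem_Icc R hc p z).1) hm.aestronglyMeasurable,
    ← AdaptiveDesign.toReal_weightedRisk R _ hc hπ, AdaptiveDesign.weightedRisk]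
  have hk : objectKernel R hj π₁ p = objectLaw R j T π₁ p := rfl
  rw [hk, lintegral_objectLaw R hm.ennreal_ofReal]
  have h (θ : Fin 2) (x : Fin T → 𝓧) : ENNReal.ofReal (objectLoss R c j p (θ, x))
      = (sprtDesign R hj p).loss (ENNReal.ofReal c) θ x := by
    rw [AdaptiveDesign.loss, sprtDesign_N, sprtDesign_D, objectLoss,
      ENNReal.ofReal_add (by split_ifs <;> norm_num) (by positivity), ENNReal.ofReal_mul hc,
      ENNReal.ofReal_natCast]
    congr 1
    split_ifs <;> simp
  simp only [h, sprtDesign_law]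

end JointMeasurability

/-! ### Conditional means and a weak law of large numbers -/

section Probability

/-- The hypothesis gives conditional probabilities of fixed sets only, whereas the integrand also
depends on the past through `e`. The joint law of `(e, z)` is therefore disintegrated on every past
event and `Y` is integrated against it. -/
theorem condExp_eq_integral_kernel {Ω Z : Type*} [MeasurableSpace Z] {m m₀ : MeasurableSpace Ω}
    {μ : Measure Ω} [IsProbabilityMeasure μ] (hm : m ≤ m₀)
    (κ : ProbabilityTheory.Kernel ℝ Z) [ProbabilityTheory.IsMarkovKernel κ]
    {e : Ω → ℝ} (he : Measurable[m] e) {z : Ω → Z} (hz : Measurable z)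
    (hcond : ∀ S, MeasurableSet S →
      μ[(z ⁻¹' S).indicator (fun _ => (1 : ℝ)) | m] =ᵐ[μ] fun ω => (κ (e ω)).real S)
    {Y : ℝ × Z → ℝ} (hY : Measurable Y) {C : ℝ} (hC : ∀ q, |Y q| ≤ C) :
    μ[fun ω => Y (e ω, z ω) | m] =ᵐ[μ] fun ω => ∫ y, Y (e ω, y) ∂(κ (e ω)) := by
  have he' : Measurable e := he.mono hm le_rfl
  have hez : Measurable fun ω => (e ω, z ω) := he'.prodMk hz
  -- Rectangles determine the law, and `e ⁻¹' B ∩ A` is again a past event, to which the defining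
  -- property of conditional expectation applies.
  have hlaw (A : Set Ω) (hA : MeasurableSet[m] A) :
      (μ.restrict A).map (fun ω => (e ω, z ω)) = ((μ.restrict A).map e).compProd κ := by
    refine Measure.ext_prod fun {B S} hB hS => ?_
    have hAB : MeasurableSet[m] (e ⁻¹' B ∩ A) := (he hB).inter hA
    have hzS : MeasurableSet (z ⁻¹' S) := hz hS
    have hκS : Measurable fun p => κ p S := κ.measurable_coe hS
    have h1 := setIntegral_condExp (μ := μ) (m := m) hm
      ((integrable_const (1 : ℝ)).indicator hzS) hAB
    rw [setIntegral_congr_ae (hm _ hAB) ((hcond S hS).mono fun ω h _ => h),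
      integral_indicator_const _ hzS, measureReal_restrict_apply hzS, smul_eq_mul, mul_one] at h1
    have h2 : ∫ ω in e ⁻¹' B ∩ A, (κ (e ω)).real S ∂μ
        = (∫⁻ ω in e ⁻¹' B ∩ A, κ (e ω) S ∂μ).toReal :=
      integral_toReal (hκS.comp he').aemeasurable
        (Eventually.of_forall fun ω => measure_lt_top _ _)
    have hfin : ∫⁻ ω in e ⁻¹' B ∩ A, κ (e ω) S ∂μ ≠ ∞ := by
      refine ne_top_of_le_ne_top (measure_ne_top (μ.restrict (e ⁻¹' B ∩ A)) univ) ?_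
      rw [← lintegral_one]
      exact lintegral_mono fun ω => prob_le_one
    rw [Measure.map_apply hez (hB.prod hS), Measure.compProd_apply_prod hB hS,
      setLIntegral_map hB hκS he', Measure.restrict_restrict (he' hB),
      Measure.restrict_apply (hez (hB.prod hS))]
    rw [h2, Measure.real, ENNReal.toReal_eq_toReal_iff' hfin (measure_ne_top _ _)] at h1
    rw [h1]
    congr 1
    ext ω
    simp only [mem_inter_iff, mem_preimage, mem_prod]
    tauto
  have hYint (ρ : Measure (ℝ × Z)) [IsFiniteMeasure ρ] : Integrable Y ρ :=
    Integrable.of_bound hY.aestronglyMeasurable C (Eventually.of_forall hC)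
  have hI : StronglyMeasurable fun p => ∫ y, Y (p, y) ∂(κ p) :=
    hY.stronglyMeasurable.integral_kernel_prod_right'
  have hIb (p : ℝ) : ‖∫ y, Y (p, y) ∂(κ p)‖ ≤ C := by
    have := norm_integral_le_of_norm_le_const (μ := κ p) (f := fun y => Y (p, y)) (C := C)
      (Eventually.of_forall fun y => hC (p, y))
    simpa using this
  have hIe : Integrable (fun ω => ∫ y, Y (e ω, y) ∂(κ (e ω))) μ :=
    Integrable.of_bound (hI.measurable.comp he').aestronglyMeasurable C
      (Eventually.of_forall fun ω => hIb (e ω))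
  refine (ae_eq_condExp_of_forall_setIntegral_eq hm ?_ (fun A _ _ => hIe.integrableOn)
    (fun A hA _ => ?_) ?_).symm
  · exact Integrable.of_bound (hY.comp hez).aestronglyMeasurable C
      (Eventually.of_forall fun ω => hC _)
  · rw [← integral_map (φ := fun ω => (e ω, z ω)) hez.aemeasurable hY.aestronglyMeasurable,
      hlaw A hA, Measure.integral_compProd (hYint _),
      integral_map he'.aemeasurable hI.aestronglyMeasurable]
  · exact (hI.measurable.comp he).stronglyMeasurable.aestronglyMeasurable

variable {Ω : Type*} {m₀ : MeasurableSpace Ω} {μ : Measure Ω} [IsProbabilityMeasure μ]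

/-- Martingale differences are orthogonal: the partial sum is known at time `K`, while the next term
has conditional mean zero. -/
theorem integral_sq_sum_le_of_condExp_eq_zero {𝓜 : ℕ → MeasurableSpace Ω} (hmono : Monotone 𝓜)
    (hle : ∀ k, 𝓜 k ≤ m₀) {ξ : ℕ → Ω → ℝ} (hξ : ∀ k, Measurable[𝓜 (k + 1)] (ξ k)) {C : ℝ}
    (hC : ∀ k ω, |ξ k ω| ≤ C) (hcond : ∀ k, μ[ξ k | 𝓜 k] =ᵐ[μ] 0) (K : ℕ) :
    ∫ ω, (∑ k ∈ Finset.range K, ξ k ω) ^ 2 ∂μ ≤ K * C ^ 2 := by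
  have hξ' (k : ℕ) : Measurable (ξ k) := (hξ k).mono (hle _) le_rfl
  have hξi (k : ℕ) : Integrable (ξ k) μ :=
    Integrable.of_bound (hξ' k).aestronglyMeasurable C (Eventually.of_forall (hC k))
  have hSb (K : ℕ) (ω : Ω) : |∑ k ∈ Finset.range K, ξ k ω| ≤ K * C := by
    refine (Finset.abs_sum_le_sum_abs _ _).trans ?_
    refine (Finset.sum_le_sum fun k _ => hC k ω).trans ?_
    simp
  have hSm (K : ℕ) : Measurable[𝓜 K] fun ω => ∑ k ∈ Finset.range K, ξ k ω :=
    Finset.measurable_sum _ fun k hk =>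
      (hξ k).mono (hmono (Nat.succ_le_of_lt (Finset.mem_range.1 hk))) le_rfl
  have hSm' (K : ℕ) : Measurable fun ω => ∑ k ∈ Finset.range K, ξ k ω :=
    (hSm K).mono (hle K) le_rfl
  induction K with
  | zero => simp
  | succ K ih =>
    have hi1 : Integrable (fun ω => (∑ k ∈ Finset.range K, ξ k ω) ^ 2) μ :=
      Integrable.of_bound ((hSm' K).pow_const 2).aestronglyMeasurable ((K * C) ^ 2)
        (Eventually.of_forall fun ω => by
          rw [norm_pow]
          exact pow_le_pow_left₀ (norm_nonneg _) (hSb K ω) 2)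
    have hi2 : Integrable ((fun ω => ∑ k ∈ Finset.range K, ξ k ω) * ξ K) μ :=
      (hξi K).bdd_mul (hSm' K).aestronglyMeasurable (Eventually.of_forall (hSb K))
    have hi3 : Integrable (fun ω => ξ K ω ^ 2) μ :=
      Integrable.of_bound ((hξ' K).pow_const 2).aestronglyMeasurable (C ^ 2)
        (Eventually.of_forall fun ω => by
          rw [norm_pow]
          exact pow_le_pow_left₀ (norm_nonneg _) (hC K ω) 2)
    have hcross : ∫ ω, ((fun ω => ∑ k ∈ Finset.range K, ξ k ω) * ξ K) ω ∂μ = 0 := by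
      rw [← integral_condExp (hle K)]
      have h := condExp_mul_of_stronglyMeasurable_left (m := 𝓜 K) (μ := μ)
        (hSm K).stronglyMeasurable hi2 (hξi K)
      rw [integral_congr_ae (h.trans ((EventuallyEq.refl _ _).mul (hcond K)))]
      simp
    have hsq : ∫ ω, ξ K ω ^ 2 ∂μ ≤ C ^ 2 := by
      refine (integral_mono hi3 (integrable_const (C ^ 2)) fun ω => ?_).trans (by simp)
      exact sq_le_sq' (abs_le.1 (hC K ω)).1 (abs_le.1 (hC K ω)).2
    have hexp : ∫ ω, (∑ k ∈ Finset.range (K + 1), ξ k ω) ^ 2 ∂μ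
        = ∫ ω, (∑ k ∈ Finset.range K, ξ k ω) ^ 2 ∂μ
          + 2 * ∫ ω, ((fun ω => ∑ k ∈ Finset.range K, ξ k ω) * ξ K) ω ∂μ
          + ∫ ω, ξ K ω ^ 2 ∂μ := by
      have hi4 : Integrable (fun ω => (∑ k ∈ Finset.range K, ξ k ω) ^ 2
          + 2 * ((fun ω => ∑ k ∈ Finset.range K, ξ k ω) * ξ K) ω) μ := hi1.add (hi2.const_mul 2)
      rw [← integral_const_mul, ← integral_add hi1 (hi2.const_mul 2), ← integral_add hi4 hi3]
      refine integral_congr_ae (Eventually.of_forall fun ω => ?_)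
      simp only [Finset.sum_range_succ, Pi.mul_apply]
      ring
    rw [hexp, hcross]
    push_cast
    linarith

theorem tendsto_integral_abs_sub_of_tendstoInMeasure {e : ℕ → Ω → ℝ} (he : ∀ k, Measurable (e k))
    {a B : ℝ} (hB : ∀ k ω, |e k ω - a| ≤ B)
    (h : TendstoInMeasure μ e atTop (fun _ => a)) :
    Tendsto (fun k => ∫ ω, |e k ω - a| ∂μ) atTop (nhds 0) := by
  have hlim := (tendstoInMeasure_iff_measureReal_dist.1 h)
  have hi (k : ℕ) : Integrable (fun ω => |e k ω - a|) μ :=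
    Integrable.of_bound ((he k).sub_const a).norm.aestronglyMeasurable B
      (Eventually.of_forall fun ω => by simpa using hB k ω)
  refine tendsto_order.2 ⟨fun b hb => Eventually.of_forall fun k =>
    hb.trans_le (integral_nonneg fun ω => abs_nonneg _), fun b hb => ?_⟩
  have h2 := (hlim (b / 2) (half_pos hb)).const_mul B
  rw [mul_zero] at h2
  filter_upwards [h2.eventually_lt_const (half_pos hb)] with k hk
  have hS : MeasurableSet {ω | b / 2 ≤ dist (e k ω) a} :=
    measurableSet_le measurable_const ((he k).dist measurable_const)
  have hle : ∀ ω, |e k ω - a| ≤ b / 2 + {ω | b / 2 ≤ dist (e k ω) a}.indicator (fun _ => B) ω := by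
    intro ω
    by_cases hω : ω ∈ {ω | b / 2 ≤ dist (e k ω) a}
    · rw [indicator_of_mem hω]
      linarith [hB k ω]
    · rw [indicator_of_notMem hω, add_zero]
      exact (not_le.1 hω).le
  have := integral_mono (hi k) ((integrable_const _).add ((integrable_const B).indicator hS)) hle
  simp only [Pi.add_apply] at this
  rw [integral_add (integrable_const _) ((integrable_const B).indicator hS),
    integral_indicator_const _ hS] at this
  simp only [integral_const, probReal_univ, smul_eq_mul, one_mul] at this
  rw [mul_comm] at hk
  linarith

/-- A weak law of large numbers for bounded variables whose conditional means converge in mean. -/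
theorem tendstoInMeasure_average_of_condExp {𝓜 : ℕ → MeasurableSpace Ω} (hmono : Monotone 𝓜)
    (hle : ∀ k, 𝓜 k ≤ m₀) {Y r : ℕ → Ω → ℝ} (hY : ∀ k, Measurable[𝓜 (k + 1)] (Y k))
    (hr : ∀ k, Measurable[𝓜 k] (r k)) {C a : ℝ} (hYC : ∀ k ω, |Y k ω| ≤ C)
    (hrC : ∀ k ω, |r k ω| ≤ C) (hcond : ∀ k, μ[Y k | 𝓜 k] =ᵐ[μ] r k)
    (hlim : Tendsto (fun k => ∫ ω, |r k ω - a| ∂μ) atTop (nhds 0)) :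
    TendstoInMeasure μ (fun (K : ℕ) ω => (1 / (K : ℝ)) * ∑ k ∈ Finset.range K, Y k ω) atTop
      (fun _ => a) := by
  have hY' (k : ℕ) : Measurable (Y k) := (hY k).mono (hle _) le_rfl
  have hr' (k : ℕ) : Measurable (r k) := (hr k).mono (hle _) le_rfl
  have hYi (k : ℕ) : Integrable (Y k) μ :=
    Integrable.of_bound (hY' k).aestronglyMeasurable C (Eventually.of_forall (hYC k))
  have hri (k : ℕ) : Integrable (r k) μ :=
    Integrable.of_bound (hr' k).aestronglyMeasurable C (Eventually.of_forall (hrC k))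
  set ξ : ℕ → Ω → ℝ := fun k => Y k - r k with hξ
  have hξm (k : ℕ) : Measurable[𝓜 (k + 1)] (ξ k) :=
    (hY k).sub ((hr k).mono (hmono k.le_succ) le_rfl)
  have hξC (k : ℕ) (ω : Ω) : |ξ k ω| ≤ 2 * C :=
    (abs_sub _ _).trans (by linarith [hYC k ω, hrC k ω])
  have hξ0 (k : ℕ) : μ[ξ k | 𝓜 k] =ᵐ[μ] 0 := by
    have h1 : μ[r k | 𝓜 k] = r k :=
      condExp_of_stronglyMeasurable (hle k) (hr k).stronglyMeasurable (hri k)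
    filter_upwards [condExp_sub (hYi k) (hri k) (𝓜 k), hcond k] with ω h2 h3
    rw [h2, Pi.sub_apply, h1, h3, sub_self, Pi.zero_apply]
  have hvar := integral_sq_sum_le_of_condExp_eq_zero hmono hle hξm hξC hξ0
  -- A bound for the mean absolute error: fluctuations of order `K ^ (-1/2)`, plus the Cesàro mean
  -- of the errors of the conditional means.
  set D : ℕ → ℝ := fun K : ℕ => (1 + (2 * C) ^ 2) * (√(K : ℝ))⁻¹
    + (K : ℝ)⁻¹ * ∑ k ∈ Finset.range K, ∫ ω, |r k ω - a| ∂μ with hD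
  have hD0 : Tendsto D atTop (nhds 0) := by
    have h1 : Tendsto (fun K : ℕ => (√(K : ℝ))⁻¹) atTop (nhds 0) :=
      tendsto_inv_atTop_zero.comp (Real.tendsto_sqrt_atTop.comp tendsto_natCast_atTop_atTop)
    simpa using (h1.const_mul (1 + (2 * C) ^ 2)).add hlim.cesaro
  have hLi (K : ℕ) : Integrable
      (fun ω => |(1 / (K : ℝ)) * ∑ k ∈ Finset.range K, Y k ω - a|) μ :=
    (((integrable_finsetSum _ fun k _ => hYi k).const_mul _).sub (integrable_const a)).abs
  have hbound : ∀ K : ℕ, 0 < K →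
      ∫ ω, |(1 / (K : ℝ)) * ∑ k ∈ Finset.range K, Y k ω - a| ∂μ ≤ D K := by
    intro K hK
    have hK' : (0 : ℝ) < K := Nat.cast_pos.2 hK
    set s := √(K : ℝ) with hs
    have hs0 : 0 < s := Real.sqrt_pos.2 hK'
    have hss : s ^ 2 = K := Real.sq_sqrt hK'.le
    have hSq : Integrable (fun ω => (∑ k ∈ Finset.range K, ξ k ω) ^ 2) μ := by
      refine Integrable.of_bound (C := (K * (2 * C)) ^ 2) ?_ (Eventually.of_forall fun ω => ?_)
      · exact ((Finset.measurable_sum _ fun k _ =>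
          (hξm k).mono (hle _) le_rfl).pow_const 2).aestronglyMeasurable
      · rw [norm_pow]
        refine pow_le_pow_left₀ (norm_nonneg _) ?_ 2
        refine (Finset.abs_sum_le_sum_abs _ _).trans ?_
        exact (Finset.sum_le_sum fun k _ => hξC k ω).trans (by simp)
    have hpt : ∀ ω, |(1 / (K : ℝ)) * ∑ k ∈ Finset.range K, Y k ω - a|
        ≤ (s⁻¹ + s⁻¹ * (K : ℝ)⁻¹ * (∑ k ∈ Finset.range K, ξ k ω) ^ 2)
          + (K : ℝ)⁻¹ * ∑ k ∈ Finset.range K, |r k ω - a| := by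
      intro ω
      have h1 : (1 / (K : ℝ)) * ∑ k ∈ Finset.range K, Y k ω - a
          = (K : ℝ)⁻¹ * (∑ k ∈ Finset.range K, ξ k ω)
            + (K : ℝ)⁻¹ * ∑ k ∈ Finset.range K, (r k ω - a) := by
        simp only [hξ, Pi.sub_apply, Finset.sum_sub_distrib, Finset.sum_const, Finset.card_range,
          nsmul_eq_mul]
        field_simp
        ring
      rw [h1]
      refine (abs_add_le _ _).trans (add_le_add ?_ ?_)
      · rw [abs_mul, abs_of_pos (inv_pos.2 hK'), ← hss]
        generalize ∑ k ∈ Finset.range K, ξ k ω = x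
        -- With `s = √K` this bounds the first absolute moment of the martingale by its second
        -- moment, without a square root of an integral.
        have h2 : |x| * s ≤ s ^ 2 + x ^ 2 := by
          nlinarith [sq_nonneg (|x| - s), sq_abs x, abs_nonneg x]
        have h3 : s⁻¹ + s⁻¹ * (s ^ 2)⁻¹ * x ^ 2 = (s ^ 2)⁻¹ * (s⁻¹ * (s ^ 2 + x ^ 2)) := by
          field_simp
        rw [h3]
        gcongr
        rw [le_inv_mul_iff₀ hs0]
        linarith
      · rw [abs_mul, abs_of_pos (inv_pos.2 hK')]
        gcongr
        exact Finset.abs_sum_le_sum_abs _ _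
    have hri' (k : ℕ) : Integrable (fun ω => |r k ω - a|) μ :=
      ((hri k).sub (integrable_const a)).abs
    have hi1 : Integrable
        (fun ω => s⁻¹ + s⁻¹ * (K : ℝ)⁻¹ * (∑ k ∈ Finset.range K, ξ k ω) ^ 2) μ :=
      (integrable_const _).add (hSq.const_mul _)
    have hi2 : Integrable (fun ω => (K : ℝ)⁻¹ * ∑ k ∈ Finset.range K, |r k ω - a|) μ :=
      (integrable_finsetSum _ fun k _ => hri' k).const_mul _
    refine (integral_mono (hLi K) (hi1.add hi2) hpt).trans ?_
    simp only [Pi.add_apply]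
    rw [integral_add hi1 hi2, integral_add (integrable_const _) (hSq.const_mul _),
      integral_const_mul, integral_const_mul, integral_finsetSum _ fun k _ => hri' k]
    simp only [integral_const, probReal_univ, smul_eq_mul, one_mul, hD, ← hs]
    gcongr
    have h4 : s⁻¹ * (K : ℝ)⁻¹ * ∫ ω, (∑ k ∈ Finset.range K, ξ k ω) ^ 2 ∂μ
        ≤ s⁻¹ * (K : ℝ)⁻¹ * (K * (2 * C) ^ 2) := by
      gcongr
      exact hvar K
    refine (add_le_add_right h4 _).trans_eq ?_
    field_simp
  refine tendstoInMeasure_iff_measureReal_dist.2 fun ε hε => ?_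
  have hlim' : Tendsto (fun K => ε⁻¹ * D K) atTop (nhds 0) := by
    simpa using hD0.const_mul ε⁻¹
  refine tendsto_of_tendsto_of_tendsto_of_le_of_le' tendsto_const_nhds hlim'
    (Eventually.of_forall fun K => measureReal_nonneg) ?_
  filter_upwards [eventually_gt_atTop 0] with K hK
  rw [le_inv_mul_iff₀ hε]
  exact (mul_meas_ge_le_integral_of_nonneg (Eventually.of_forall fun ω => abs_nonneg _)
    (hLi K) ε).trans (hbound K hK)

end Probability

/-! ### The empirical Bayes run -/

section Run

variable {M T : ℕ} {𝓧 Ω : Type*} [MeasurableSpace 𝓧]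

theorem monotone_pastSigma (θ : ℕ → Ω → Fin 2) (X : ℕ → Ω → Fin T → 𝓧) :
    Monotone (pastSigma θ X) := fun _ _ hkl =>
  iSup_le fun i => le_iSup (fun i : Fin _ =>
    MeasurableSpace.comap (fun ω => (θ i ω, X i ω)) inferInstance) (Fin.castLE hkl i)

theorem measurable_object_pastSigma (θ : ℕ → Ω → Fin 2) (X : ℕ → Ω → Fin T → 𝓧) (k : ℕ) :
    Measurable[pastSigma θ X (k + 1)] fun ω => (θ k ω, X k ω) :=
  (comap_measurable _).mono (le_iSup (fun i : Fin (k + 1) =>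
    MeasurableSpace.comap (fun ω => (θ i ω, X i ω)) inferInstance) (Fin.last k)) le_rfl

namespace IsEmpiricalBayesRun

variable [MeasurableSpace Ω] {R : ResponseModel M 𝓧} {c π₁ : ℝ}
  {j : ℝ → ℕ → EReal → Fin M} {μ : Measure Ω}
  {θ : ℕ → Ω → Fin 2} {X : ℕ → Ω → Fin T → 𝓧} {est : ℕ → Ω → ℝ}

theorem pastSigma_le (hrun : IsEmpiricalBayesRun R c π₁ j μ θ X est) (k : ℕ) :
    pastSigma θ X k ≤ ‹MeasurableSpace Ω› :=
  iSup_le fun i => ((hrun.measurable_label i).prodMk (hrun.measurable_resp i)).comap_le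

/-- Which responses of an object are collected depends on its sample size, hence on its own
estimate. Strong induction unwinds this circle: earlier estimates are already functions of the past.
-/
theorem measurable_est [Nonempty (Fin M)] (hrun : IsEmpiricalBayesRun R c π₁ j μ θ X est)
    (hc : 0 ≤ c) (hj : IsSelectionRule R c T j) (k : ℕ) :
    Measurable[pastSigma θ X k] (est k) := by
  induction k using Nat.strong_induction_on with
  | _ k ih =>
    refine (hrun.est_collected k).mono (MeasurableSpace.generateFrom_le ?_) le_rfl
    rintro E ⟨i, hik, n, S, hS, rfl⟩
    have hle : pastSigma θ X (i + 1) ≤ pastSigma θ X k := monotone_pastSigma θ X hik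
    have hX : Measurable[pastSigma θ X k] (X i) :=
      measurable_snd.comp ((measurable_object_pastSigma θ X i).mono hle le_rfl)
    have he : Measurable[pastSigma θ X k] (est i) :=
      (ih i hik).mono (monotone_pastSigma θ X hik.le) le_rfl
    have hN : Measurable[pastSigma θ X k] fun ω => sprtN R c j (est i ω) (X i ω) :=
      Measurable.comp (g := fun q : ℝ × (Fin T → 𝓧) => sprtN R c j q.1 q.2)
        (f := fun ω => (est i ω, X i ω)) (measurable_sprtN R hc hj) (he.prodMk hX)
    have h1 : MeasurableSet[pastSigma θ X k] {ω | (n : ℕ) < sprtN R c j (est i ω) (X i ω)} :=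
      hN (measurableSet_Ioi (a := (n : ℕ)))
    have h2 : MeasurableSet[pastSigma θ X k] {ω | X i ω n ∈ S} :=
      (measurable_pi_apply n).comp hX hS
    exact h1.inter h2

end IsEmpiricalBayesRun

end Run

theorem mainTheorem4 {M T : ℕ} {𝓧 Ω : Type*} [MeasurableSpace 𝓧] [MeasurableSpace Ω]
    (R : ResponseModel M 𝓧) (c π₁ : ℝ) (hc : 0 ≤ c) (hcπ : c < π₁) (hπc : π₁ < 1 - c)
    (j : ℝ → ℕ → EReal → Fin M) (hj : IsSelectionRule R c T j)
    (μ : Measure Ω) [IsProbabilityMeasure μ]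
    (θ : ℕ → Ω → Fin 2) (X : ℕ → Ω → Fin T → 𝓧) (est : ℕ → Ω → ℝ)
    (hrun : IsEmpiricalBayesRun R c π₁ j μ θ X est)
    (hcons : TendstoInMeasure μ est atTop (fun _ => π₁)) :
    ∃ m : ℝ,
      IsLeast (Set.range (fun d : AdaptiveDesign M T 𝓧 => bayesRisk R c π₁ d)) m ∧
      TendstoInMeasure μ (averagedLoss R c j θ X est) atTop (fun _ => m) := by
  -- A selection rule names an experiment, so the pool cannot be empty.
  have hM : Nonempty (Fin M) := ⟨j 0 0 0⟩
  have hπ : π₁ ∈ Ioo (0 : ℝ) 1 := ⟨by linarith, by linarith⟩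
  have hπ' : π₁ ∈ Icc (0 : ℝ) 1 := ⟨hπ.1.le, hπ.2.le⟩
  refine ⟨bayesRisk R c π₁ (sprtDesign R hj π₁), ⟨⟨_, rfl⟩, ?_⟩, ?_⟩
  · rintro _ ⟨d, rfl⟩
    exact bayesRisk_sprtDesign_le R hj hc hπ d
  set C : ℝ := 1 + c * T with hC
  set m := bayesRisk R c π₁ (sprtDesign R hj π₁) with hm
  have hκ := isMarkovKernel_objectKernel R hj hπ'
  have hest := hrun.measurable_est hc hj
  have hle := hrun.pastSigma_le
  have hL := measurable_objectLoss R hc hj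
  have hLC (q : ℝ × (Fin 2 × (Fin T → 𝓧))) : |objectLoss R c j q.1 q.2| ≤ C := by
    rw [abs_of_nonneg (objectLoss_mem_Icc R hc q.1 q.2).1]
    exact (objectLoss_mem_Icc R hc q.1 q.2).2
  -- The risk of the test is measurable in the prior because it is the integral of the jointly
  -- measurable loss against a kernel.
  have hρ : Measurable fun p => bayesRisk R c π₁ (sprtDesign (T := T) R hj p) := by
    have h : StronglyMeasurable fun p => ∫ z, objectLoss R c j p z ∂(objectKernel R hj π₁ p) :=
      hL.stronglyMeasurable.integral_kernel_prod_right'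
    simpa only [integral_objectLoss R hc hj hπ'] using h.measurable
  have hρC (p : ℝ) : |bayesRisk R c π₁ (sprtDesign (T := T) R hj p)| ≤ C := by
    rw [abs_of_nonneg ((sprtDesign R hj p).bayesRisk_nonneg R hc hπ')]
    exact (sprtDesign R hj p).bayesRisk_le R hc hπ'
  have hestm (k : ℕ) : Measurable (est k) := (hest k).mono (hle k) le_rfl
  obtain ⟨L, hL0, hLip⟩ := exists_abs_bayesRisk_sprtDesign_sub_le (T := T) R hj hc hπ
  have hestB (k : ℕ) (ω : Ω) : |est k ω - π₁| ≤ 1 :=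
    abs_le.2 ⟨by linarith [(hrun.est_mem k ω).1, hπ.2], by linarith [(hrun.est_mem k ω).2, hπ.1]⟩
  have hlim := tendsto_integral_abs_sub_of_tendstoInMeasure hestm hestB hcons
  refine tendstoInMeasure_average_of_condExp (monotone_pastSigma θ X) hle
    (Y := fun k ω => objectLoss R c j (est k ω) (θ k ω, X k ω))
    (r := fun k ω => bayesRisk R c π₁ (sprtDesign R hj (est k ω)))
    (fun k => ?_) (fun k => hρ.comp (hest k)) (fun k ω => hLC (est k ω, (θ k ω, X k ω)))
    (fun k ω => hρC _) (fun k => ?_) ?_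
  · exact Measurable.comp
      (g := fun q : ℝ × (Fin 2 × (Fin T → 𝓧)) => objectLoss R c j q.1 q.2)
      (f := fun ω => (est k ω, (θ k ω, X k ω))) hL
      (((hest k).mono (monotone_pastSigma θ X k.le_succ) le_rfl).prodMk
        (measurable_object_pastSigma θ X k))
  · have h := condExp_eq_integral_kernel
      (Y := fun q : ℝ × (Fin 2 × (Fin T → 𝓧)) => objectLoss R c j q.1 q.2)
      (z := fun ω => (θ k ω, X k ω)) (hle k) (objectKernel R hj π₁) (hest k)
      ((hrun.measurable_label k).prodMk (hrun.measurable_resp k)) (hrun.condLaw k)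
      hL hLC
    simpa only [integral_objectLoss R hc hj hπ'] using h
  -- The Lipschitz bound carries convergence in mean of the estimates over to the conditional risks.
  · refine squeeze_zero (fun k => integral_nonneg fun ω => abs_nonneg _) (fun k => ?_)
      (by simpa using hlim.const_mul L)
    rw [← integral_const_mul]
    refine integral_mono ?_ ?_ fun ω => hLip _ (hrun.est_mem k ω)
    · exact Integrable.of_bound (C := C + |m|)
        ((hρ.comp (hestm k)).sub_const m).norm.aestronglyMeasurable
        (Eventually.of_forall fun ω => by
          rw [Real.norm_eq_abs, abs_abs]
          exact (abs_sub _ _).trans (add_le_add_left (hρC _) _))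
    · exact (Integrable.of_bound (C := 1) ((hestm k).sub_const π₁).norm.aestronglyMeasurable
        (Eventually.of_forall fun ω => by simpa using hestB k ω)).const_mul L
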